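/- Let $n,m,r,t\ge 0$ be integers with $m<n$, $r<n$, $t\le\min(n-m,n-r)$. Notation. For $k\le n$ and $g=\begin{pmatrix}A&B\\C&D\end{pmatrix}\in Sp_k(\mathbb Z)$ put $g^{\uparrow_n}=\begin{pmatrix}A&0&B&0\\0&1_{n-k}&0&0\\C&0&D&0\\0&0&0&1_{n-k}\end{pmatrix}\in Sp_n(\mathbb Z)$, and for $U\in GL_n(\mathbb Z)$ put $L(U)=\begin{pmatrix}{}^tU^{-1}&0\\0&U\end{pmatrix}\in Sp_n(\mathbb Z)$. For $0\le b\le a$ let $C_{a,b}$ be the group of all $g=(g_{ij})\in Sp_a(\mathbb Z)$ with $g_{ij}=0$ for $i>a+b$, $j\le a+b$, and let $J_{a,b}\subseteq C_{a,b}$ be the subgroup of those $g$ whose lower right $(a-b)\times(a-b)$ block is the identity matrix. For integers $a,b,c,t\ge 0$ with $b,c\le a$ let $M_{a,b,c}^t$ be the set of all $\begin{pmatrix}A&B\\C&D\end{pmatrix}\in Sp_a(\mathbb Z)$ for which the lower right $(a-b)\times(a-c)$ block of $C$ has rank $t$. For $s\le r\le a$ let $\tilde Q_s^{r,a-r}$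 be the group of all $\begin{pmatrix}A&B\\C&D\end{pmatrix}\in Sp_a(\mathbb Z)$ which, with rows and columns of $C$ and $D$ divided into blocks of sizes $s,\ a-r,\ r-s$, satisfy $$C=\begin{pmatrix}*&0&0\\0&0&0\\0&0&0\end{pmatrix},\qquad D=\begin{pmatrix}*&*&*\\0&1_{a-r}&*\\0&0&*\end{pmatrix}.$$ For $k\le N$ let $GL_N^{k,*}(\mathbb Z)$ be the set of matrices in $GL_N(\mathbb Z)$ whose $k\times k$ block in the lower left corner has full rank $k$. For each integer $s$ with $\max(r+m+t-n,0)\le s\le\min(m,r)$ choose: * a set $\mathcal R_1^s$ of representatives of the double cosets in $L^{-1}(C_{m+r+t-2s,\,m+t-s})\backslash GL_{m+r+t-2s}^{r-s,*}(\mathbb Z)/L^{-1}(J_{m+r+t-2s,\,r-s})$; * a set $\mathcal R_2^s$ of representatives of the cosets in $\left\{\begin{pmatrix}*&*\\0_{n-m-t+s-r,\,m+t-s}&*\end{pmatrix}\in GL_{n-r}(\mathbb Z)\right\}\backslash GL_{n-r}(\mathbb Z)$; * a set $\Gamma_1^s$ of representatives of $C_{m+t,m}\backslash M_{m+t,m,s}^t$;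 * for each $u\in\mathcal R_1^s$, with $\hat u=\mathrm{diag}(1_s,u,1_{n+s-m-t-r})$, a set $\Gamma_2^{s,u}$ of representatives of $$\bigl(J_{m+t+r-s,r}^{\uparrow_n}\cap L(\hat u^{-1})(\tilde Q_s^{r,m+t-s})^{\uparrow_n}L(\hat u)\bigr)\backslash J_{m+t+r-s,r}^{\uparrow_n},$$ where $\tilde Q_s^{r,m+t-s}\subseteq Sp_{m+t+r-s}(\mathbb Z)$. For $u'\in GL_{n-r}(\mathbb Z)$ put $\tilde u'=\mathrm{diag}(1_r,u')\in GL_n(\mathbb Z)$. Then the matrices $$\gamma_1^{\uparrow_n}L(\hat u)\gamma_2L(\tilde u'),\qquad \max(r+m+t-n,0)\le s\le\min(m,r),\ u\in\mathcal R_1^s,\ u'\in\mathcal R_2^s,\ \gamma_1\in\Gamma_1^s,\ \gamma_2\in\Gamma_2^{s,u},$$ form a set of representatives of the cosets in $C_{n,m}\backslash M_{n,m,r}^t$, and different parameters $(s,\gamma_1,u,\gamma_2,u')$ give different matrices. -/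

import Mathlib

namespace SpCosets

open Matrix

/-- The integral symplectic group `Sp_n(ℤ)`; its elements are `2n × 2n` matrices, the first `n`
indices being `Sum.inl i` and the last `n` indices being `Sum.inr i`. -/
abbrev Sp (n : ℕ) : Type := ↥(Matrix.symplecticGroup (Fin n) ℤ)

/-- The group `GL_n(ℤ)`. -/
abbrev GLZ (n : ℕ) : Type := Matrix.GeneralLinearGroup (Fin n) ℤ

/-- Put the `k × k` matrix `A` at the diagonal position `off + 1, …, off + k` of an `n × n` matrix
that is `e` times the identity elsewhere: `diag(e · 1_off, A, e · 1_{n - off - k})`. -/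
def pad {k : ℕ} (off n : ℕ) (e : ℤ) (A : Matrix (Fin k) (Fin k) ℤ) :
    Matrix (Fin n) (Fin n) ℤ :=
  Matrix.of fun i j =>
    if h : (off ≤ (i : ℕ) ∧ (i : ℕ) < off + k) ∧ (off ≤ (j : ℕ) ∧ (j : ℕ) < off + k) then
      A ⟨(i : ℕ) - off, by omega⟩ ⟨(j : ℕ) - off, by omega⟩
    else if i = j then e else 0

theorem pad_mul {k off n : ℕ} (h : off + k ≤ n) (e e' : ℤ) (A B : Matrix (Fin k) (Fin k) ℤ) :
    pad off n e A * pad off n e' B = pad off n (e * e') (A * B) := by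
  ext i j
  rw [Matrix.mul_apply]
  by_cases hi : off ≤ (i : ℕ) ∧ (i : ℕ) < off + k
  · let f : Fin k → Fin n := fun a => ⟨off + a, by omega⟩
    have hf : Function.Injective f := by
      intro a b hab
      have := congrArg Fin.val hab
      simp only [f] at this
      exact Fin.ext (by omega)
    by_cases hj : off ≤ (j : ℕ) ∧ (j : ℕ) < off + k
    · rw [← Fintype.sum_of_injective f hf
        (fun a => A ⟨(i : ℕ) - off, by omega⟩ a * B a ⟨(j : ℕ) - off, by omega⟩)]
      · simp [pad, hi, hj, Matrix.mul_apply]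
      · intro l hl
        have hl' : ¬ (off ≤ (l : ℕ) ∧ (l : ℕ) < off + k) := by
          rintro ⟨h1, h2⟩
          exact hl ⟨⟨(l : ℕ) - off, by omega⟩, Fin.ext (by simp only [f]; omega)⟩
        have hil : i ≠ l := by rintro rfl; exact hl' hi
        simp only [pad, Matrix.of_apply, hl', and_false, dite_false, if_neg hil, zero_mul]
      · intro a
        simp [pad, hi, hj, f]
    · have hij : i ≠ j := by rintro rfl; exact hj hi
      simp only [pad, Matrix.of_apply, hj, and_false, dite_false, if_neg hij]
      refine Finset.sum_eq_zero fun l _ => ?_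
      by_cases hlj : l = j
      · subst hlj
        simp only [hj, and_false, dite_false, if_neg hij, zero_mul]
      · simp only [if_neg hlj, mul_zero]
  · simp only [pad, Matrix.of_apply, hi, false_and, dite_false]
    rw [Finset.sum_eq_single i]
    · simp only [hi, false_and, dite_false, if_true]
      split_ifs <;> simp
    · intro l _ hl
      rw [if_neg (Ne.symm hl), zero_mul]
    · simp

theorem pad_one {k : ℕ} (off n : ℕ) : pad off n 1 (1 : Matrix (Fin k) (Fin k) ℤ) = 1 := by
  ext i j
  simp only [pad, Matrix.of_apply, Matrix.one_apply, Fin.ext_iff]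
  split_ifs <;> first | rfl | omega

theorem pad_transpose {k : ℕ} (off n : ℕ) (e : ℤ) (A : Matrix (Fin k) (Fin k) ℤ) :
    (pad off n e A)ᵀ = pad off n e Aᵀ := by
  ext i j
  simp only [pad, Matrix.of_apply, Matrix.transpose_apply, Fin.ext_iff]
  split_ifs <;> first | rfl | omega

theorem pad_add {k : ℕ} (off n : ℕ) (e e' : ℤ) (A B : Matrix (Fin k) (Fin k) ℤ) :
    pad off n e A + pad off n e' B = pad off n (e + e') (A + B) := by
  ext i j
  simp only [pad, Matrix.of_apply, Matrix.add_apply]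
  split_ifs <;> simp

theorem pad_neg {k : ℕ} (off n : ℕ) (e : ℤ) (A : Matrix (Fin k) (Fin k) ℤ) :
    -pad off n e A = pad off n (-e) (-A) := by
  ext i j
  simp only [pad, Matrix.of_apply, Matrix.neg_apply]
  split_ifs <;> simp

theorem pad_zero {k : ℕ} (off n : ℕ) : pad off n 0 (0 : Matrix (Fin k) (Fin k) ℤ) = 0 := by
  ext i j
  simp [pad]

/-- For `off + k ≤ n`, the homomorphism `U ↦ diag(1_off, U, 1_{n - off - k})` from `GL_k(ℤ)` to
`GL_n(ℤ)`. (It is not used when `off + k > n`, and is trivial then.) -/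
def blockGL {k : ℕ} (off n : ℕ) : GLZ k →* GLZ n :=
  if h : off + k ≤ n then
    Units.map
      { toFun := fun A => pad off n 1 A
        map_one' := pad_one off n
        map_mul' := fun A B => by simp [pad_mul h] }
  else 1

/-- The matrix of `g^{↑n}`: with `g = (A, B; C, D)` this is
`(A 0 B 0; 0 1 0 0; C 0 D 0; 0 0 0 1)`. -/
def upMatrix {k : ℕ} (n : ℕ) (g : Matrix (Fin k ⊕ Fin k) (Fin k ⊕ Fin k) ℤ) :
    Matrix (Fin n ⊕ Fin n) (Fin n ⊕ Fin n) ℤ :=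
  Matrix.fromBlocks (pad 0 n 1 g.toBlocks₁₁) (pad 0 n 0 g.toBlocks₁₂)
    (pad 0 n 0 g.toBlocks₂₁) (pad 0 n 1 g.toBlocks₂₂)

theorem upMatrix_mul {k n : ℕ} (h : k ≤ n) (g g' : Matrix (Fin k ⊕ Fin k) (Fin k ⊕ Fin k) ℤ) :
    upMatrix n g * upMatrix n g' = upMatrix n (g * g') := by
  have h0 : 0 + k ≤ n := by omega
  conv_rhs => rw [← fromBlocks_toBlocks g, ← fromBlocks_toBlocks g']
  simp [upMatrix, fromBlocks_multiply, pad_mul h0, pad_add]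

theorem upMatrix_one {k : ℕ} (n : ℕ) :
    upMatrix n (1 : Matrix (Fin k ⊕ Fin k) (Fin k ⊕ Fin k) ℤ) = 1 := by
  have h11 : (1 : Matrix (Fin k ⊕ Fin k) (Fin k ⊕ Fin k) ℤ).toBlocks₁₁ = 1 := by
    ext i j; simp [toBlocks₁₁, Matrix.one_apply]
  have h12 : (1 : Matrix (Fin k ⊕ Fin k) (Fin k ⊕ Fin k) ℤ).toBlocks₁₂ = 0 := by
    ext i j; simp [toBlocks₁₂]
  have h21 : (1 : Matrix (Fin k ⊕ Fin k) (Fin k ⊕ Fin k) ℤ).toBlocks₂₁ = 0 := by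
    ext i j; simp [toBlocks₂₁]
  have h22 : (1 : Matrix (Fin k ⊕ Fin k) (Fin k ⊕ Fin k) ℤ).toBlocks₂₂ = 1 := by
    ext i j; simp [toBlocks₂₂, Matrix.one_apply]
  rw [upMatrix, h11, h12, h21, h22, pad_one, pad_zero, fromBlocks_one]

theorem upMatrix_mem {k n : ℕ} (h : k ≤ n) {g : Matrix (Fin k ⊕ Fin k) (Fin k ⊕ Fin k) ℤ}
    (hg : g ∈ Matrix.symplecticGroup (Fin k) ℤ) :
    upMatrix n g ∈ Matrix.symplecticGroup (Fin n) ℤ := by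
  have h0 : 0 + k ≤ n := by omega
  rw [SymplecticGroup.mem_iff] at hg ⊢
  rw [← fromBlocks_toBlocks g] at hg
  simp only [Matrix.J, fromBlocks_transpose, fromBlocks_multiply, fromBlocks_inj] at hg
  obtain ⟨h1, h2, h3, h4⟩ := hg
  have hz : (0 : Matrix (Fin n) (Fin n) ℤ) = pad 0 n 0 (0 : Matrix (Fin k) (Fin k) ℤ) :=
    (pad_zero 0 n).symm
  have ho : (1 : Matrix (Fin n) (Fin n) ℤ) = pad 0 n 1 (1 : Matrix (Fin k) (Fin k) ℤ) :=
    (pad_one 0 n).symm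
  simp only [Matrix.J, upMatrix, fromBlocks_transpose, fromBlocks_multiply, fromBlocks_inj, hz, ho,
    pad_neg, pad_transpose, pad_mul h0, pad_add, h1, h2, h3, h4]
  simp

/-- For `k ≤ n`, the homomorphism `g ↦ g^{↑n}` from `Sp_k(ℤ)` to `Sp_n(ℤ)`; it is the identity for
`k = n`. (It is not used when `k > n`, and is trivial then.) -/
def up {k : ℕ} (n : ℕ) : Sp k →* Sp n :=
  if h : k ≤ n then
    { toFun := fun g => ⟨upMatrix n g.1, upMatrix_mem h g.2⟩
      map_one' := Subtype.ext (upMatrix_one n)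
      map_mul' := fun g g' => Subtype.ext (upMatrix_mul h g.1 g'.1).symm }
  else 1

/-- The homomorphism `L(U) = ((U⁻¹)ᵀ, 0; 0, U)` from `GL_n(ℤ)` to `Sp_n(ℤ)`. -/
def L {n : ℕ} : GLZ n →* Sp n where
  toFun U := ⟨Matrix.fromBlocks (U⁻¹).1ᵀ 0 0 U.1, by
    have h1 : (U⁻¹).1ᵀ * U.1ᵀ = 1 := by
      rw [← Matrix.transpose_mul, ← Units.val_mul, mul_inv_cancel, Units.val_one,
        Matrix.transpose_one]
    have h2 : U.1 * (U⁻¹).1 = 1 := by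
      rw [← Units.val_mul, mul_inv_cancel, Units.val_one]
    rw [SymplecticGroup.mem_iff]
    simp [Matrix.J, fromBlocks_transpose, fromBlocks_multiply, -Matrix.coe_units_inv, h1, h2]⟩
  map_one' := Subtype.ext (by simp)
  map_mul' U V := Subtype.ext (by
    simp [fromBlocks_multiply, -Matrix.coe_units_inv, Matrix.transpose_mul])

/-- `C_{n,r}`: the `g ∈ Sp_n(ℤ)` with `g_{ij} = 0` for `i > n + r`, `j ≤ n + r`. -/
def C (n r : ℕ) : Set (Sp n) :=
  {g | (∀ i j : Fin n, r ≤ (i : ℕ) → g.1 (Sum.inr i) (Sum.inl j) = 0) ∧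
    ∀ i j : Fin n, r ≤ (i : ℕ) → (j : ℕ) < r → g.1 (Sum.inr i) (Sum.inr j) = 0}

/-- The Jacobi group `J_{n,r}`: the elements of `C_{n,r}` with an `(n-r) × (n-r)` identity matrix
in the lower right hand corner. -/
def J (n r : ℕ) : Set (Sp n) :=
  {g | g ∈ C n r ∧ ∀ i j : Fin n, r ≤ (i : ℕ) → r ≤ (j : ℕ) →
    g.1 (Sum.inr i) (Sum.inr j) = if i = j then 1 else 0}

/-- The group `Q̃_s^{r,n-r}` (for `s ≤ r ≤ n`): with index blocks of sizes `s`, `n-r`, `r-s`, the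
`(A, B; C, D) ∈ Sp_n(ℤ)` with `C = (* 0 0; 0 0 0; 0 0 0)` and `D = (* * *; 0 1 *; 0 0 *)`. -/
def Qtilde (n r s : ℕ) : Set (Sp n) :=
  {g | (∀ i j : Fin n, ¬ ((i : ℕ) < s ∧ (j : ℕ) < s) → g.1 (Sum.inr i) (Sum.inl j) = 0) ∧
    (∀ i j : Fin n, s ≤ (i : ℕ) → (j : ℕ) < s → g.1 (Sum.inr i) (Sum.inr j) = 0) ∧
    (∀ i j : Fin n, s ≤ (i : ℕ) → (i : ℕ) < s + (n - r) → s ≤ (j : ℕ) → (j : ℕ) < s + (n - r) →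
      g.1 (Sum.inr i) (Sum.inr j) = if i = j then 1 else 0) ∧
    ∀ i j : Fin n, s + (n - r) ≤ (i : ℕ) → s ≤ (j : ℕ) → (j : ℕ) < s + (n - r) →
      g.1 (Sum.inr i) (Sum.inr j) = 0}

/-- `M_{n,m,r}^t`: the `(A, B; C, D) ∈ Sp_n(ℤ)` for which the lower right `(n-m) × (n-r)` block of
`C` has rank `t`. -/
def M (n m r t : ℕ) : Set (Sp n) :=
  {g | (g.1.submatrix (fun i : {i : Fin n // m ≤ (i : ℕ)} => Sum.inr i.1)
    (fun j : {j : Fin n // r ≤ (j : ℕ)} => Sum.inl j.1)).rank = t}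

/-- `GL_N^{k,*}(ℤ)`: the matrices in `GL_N(ℤ)` whose `k × k` block in the lower left corner has
full rank `k`. -/
def GLstar (N k : ℕ) : Set (GLZ N) :=
  {u | (u.1.submatrix (fun i : {i : Fin N // N - k ≤ (i : ℕ)} => i.1)
    (fun j : {j : Fin N // (j : ℕ) < k} => j.1)).rank = k}

/-- The `U ∈ GL_N(ℤ)` whose lower left block of size `(N - a) × a` is zero. -/
def parabolicGL (N a : ℕ) : Set (GLZ N) :=
  {U | ∀ i j : Fin N, a ≤ (i : ℕ) → (j : ℕ) < a → U.1 i j = 0}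

/-- `S` is a set of representatives of the cosets in `H \ X` (`H` a subgroup of `G`, `X` a subset
of `G` with `H X = X`). -/
def IsCosetReps {G : Type*} [Group G] (H X S : Set G) : Prop :=
  S ⊆ X ∧ ∀ g ∈ X, ∃! x, x ∈ S ∧ ∃ h ∈ H, g = h * x

/-- `S` is a set of representatives of the double cosets in `H \ X / K` (`H`, `K` subgroups of `G`,
`X` a subset of `G` with `H X K = X`). -/
def IsDoubleCosetReps {G : Type*} [Group G] (H K X S : Set G) : Prop :=
  S ⊆ X ∧ ∀ g ∈ X, ∃! x, x ∈ S ∧ ∃ h ∈ H, ∃ k ∈ K, g = h * x * k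

/-- `û = diag(1_s, u, 1_{n+s-m-t-r})` for `u ∈ GL_{m+r+t-2s}(ℤ)`. -/
def hatGL {N : ℕ} (n s : ℕ) (u : GLZ N) : GLZ n := blockGL s n u

/-- `ũ' = diag(1_r, u')` for `u' ∈ GL_{n-r}(ℤ)`. -/
def tildeGL (n r : ℕ) (u' : GLZ (n - r)) : GLZ n := blockGL r n u'

/-- The set `J_{k,r}^{↑n} ⊆ Sp_n(ℤ)`. -/
def Jup (n k r : ℕ) : Set (Sp n) := up n '' J k r

/-- The group `J_{k,r}^{↑n} ∩ L(û⁻¹) (Q̃_s^{r,k-r})^{↑n} L(û)`, where `v = û`. -/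
def gammaTwoGroup (n k r s : ℕ) (v : GLZ n) : Set (Sp n) :=
  Jup n k r ∩ {g | ∃ q ∈ Qtilde k r s, g = L v⁻¹ * up n q * L v}

/-- The parameters `(s, γ₁, u, γ₂, u')`. -/
abbrev Param (n m r t : ℕ) : Type :=
  Σ s : ℕ, Sp (m + t) × GLZ (m + r + t - 2 * s) × Sp n × GLZ (n - r)

/-- The matrix `γ₁^{↑n} L(û) γ₂ L(ũ')`. -/
def repMatrix (n m r t : ℕ) : Param n m r t → Sp n
  | ⟨s, γ₁, u, γ₂, u'⟩ => up n γ₁ * L (hatGL n s u) * γ₂ * L (tildeGL n r u')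

/-- The parameters with `max(r+m+t-n, 0) ≤ s ≤ min(m, r)` (the subtraction of natural numbers is
truncated at `0`), `u ∈ R₁ s`, `u' ∈ R₂ s`, `γ₁ ∈ Γ₁ s` and `γ₂ ∈ Γ₂ s u`. -/
def paramSet (n m r t : ℕ)
    (R₁ : (s : ℕ) → Set (GLZ (m + r + t - 2 * s))) (R₂ : ℕ → Set (GLZ (n - r)))
    (Γ₁ : ℕ → Set (Sp (m + t))) (Γ₂ : (s : ℕ) → GLZ (m + r + t - 2 * s) → Set (Sp n)) :
    Set (Param n m r t) :=
  {x | x.1 ∈ Set.Icc (r + m + t - n) (min m r) ∧ x.2.1 ∈ Γ₁ x.1 ∧ x.2.2.1 ∈ R₁ x.1 ∧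
    x.2.2.2.1 ∈ Γ₂ x.1 x.2.2.1 ∧ x.2.2.2.2 ∈ R₂ x.1}

end SpCosets

namespace SpCosets

open Matrix

/-! ### Finitely generated abelian groups -/

/-! Let `Sp n` act on row vectors from the right. Then `C n m` is the stabilizer of the isotropic
saturated subgroup `F n m`, so a coset of `C n m` is the same thing as a translate `W = (F n m) g`
(`exists_mem_C_mul_iff`). `J n r` is the pointwise stabilizer of `F n r`, and `P n r` is the
orthogonal complement of `F n r`. The rank condition defining `M n m r t` says that `W ∩ P n r` has
rank `n - m - t` (`mem_M_iff`). The theorem thus classifies subgroups `W` relative to the flag `F n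
r ≤ P n r`, and the parameters are read off from `W ∩ F n r ≤ W ∩ P n r ≤ W`.

The saturated subgroup `W ∩ F n r` of `F n r` has rank `n - r - (m + t - s)`; this determines `s`,
and its position determines `u'` (`exists_inf_F_eq`). After translating back by `ũ'` it is standard.

Modulo `F n r`, the group `W ∩ P n r` becomes isotropic of rank `r - s` in `ℤ^{2r}`. Since `Sp r` is
transitive on saturated isotropic subgroups of given rank (`exists_img_F_eq`), an element of the
Jacobi group moves `W ∩ P n r` into `F n s`. There it is described by a matrix `u`, and the
condition on `W ∩ F n r` becomes `u ∈ GLstar` (`exists_inf_P_eq`). Two such descriptions differ by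
an element of the Jacobi group, which accounts for the double coset of `u`
(`exists_double_coset_eq`); the stabilizer of the translate of `F n (m + t)` by `û` accounts for the
coset of `γ₂` (`mem_gammaTwoGroup_of_img_eq`).

Finally, once `W ∩ P n r` is moved to `F n (m + t)`, isotropy makes `W` the preimage of a subgroup
of `ℤ^{2(m+t)}`, which is the choice of `γ₁` (`exists_rep_of_inf_P_eq`). Conversely, `img_rep_inf_P`
and `img_rep_inf_F` recover both intersections from the parameters. -/

theorem comap_eq_of_le_comap {M : Type*} [AddCommGroup M] [IsNoetherian ℤ M] (e : M ≃ₗ[ℤ] M)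
    {F : Submodule ℤ M} (h : F ≤ F.comap e.toLinearMap) : F.comap e.toLinearMap = F := by
  have hiter : ∀ k : ℕ, F.comap (e ^ (k + 1)).toLinearMap
      = (F.comap e.toLinearMap).comap (e ^ k).toLinearMap := by
    intro k
    ext x
    simp [pow_succ']
  -- The preimages of `F` under the powers of `e` ascend, hence become stationary; cancelling the
  -- surjection `e ^ k` gives equality at the first step.
  let f : ℕ →o Submodule ℤ M :=
    ⟨fun k => F.comap (e ^ k).toLinearMap, monotone_nat_of_le_succ fun k => by
      rw [hiter]
      exact Submodule.comap_mono h⟩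
  obtain ⟨k, hk⟩ := monotone_stabilizes_iff_noetherian.mpr ‹IsNoetherian ℤ M› f
  have h1 : F.comap (e ^ k).toLinearMap = (F.comap e.toLinearMap).comap (e ^ k).toLinearMap := by
    rw [← hiter]
    exact hk (k + 1) (Nat.le_succ k)
  exact (Submodule.comap_injective_of_surjective (e ^ k).surjective h1).symm

theorem finrank_comap_equiv {M : Type*} [AddCommGroup M] (e : M ≃ₗ[ℤ] M) (F : Submodule ℤ M) :
    Module.finrank ℤ (F.comap e.toLinearMap) = Module.finrank ℤ F := by
  have h : F.comap e.toLinearMap = F.map e.symm.toLinearMap := by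
    ext x
    constructor
    · intro hx
      exact ⟨e x, hx, by simp⟩
    · rintro ⟨y, hy, rfl⟩
      simpa using hy
  rw [h]
  exact (e.symm.submoduleMap F).finrank_eq.symm

/-- A subgroup is saturated if the quotient by it is torsion free. -/
def Sat {M : Type*} [AddCommGroup M] (W : Submodule ℤ M) : Prop :=
  ∀ c : ℤ, c ≠ 0 → ∀ x : M, c • x ∈ W → x ∈ W

theorem Sat.inf {M : Type*} [AddCommGroup M] {W W' : Submodule ℤ M} (h : Sat W) (h' : Sat W') :
    Sat (W ⊓ W') :=
  fun c hc x hx => ⟨h c hc x hx.1, h' c hc x hx.2⟩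

theorem Sat.comap {M M' : Type*} [AddCommGroup M] [AddCommGroup M'] {W : Submodule ℤ M}
    (h : Sat W) (f : M' →ₗ[ℤ] M) : Sat (W.comap f) :=
  fun c hc x hx => h c hc (f x) (by simpa using hx)

/-- The saturation of a subgroup. -/
def saturation {M : Type*} [AddCommGroup M] (W : Submodule ℤ M) : Submodule ℤ M where
  carrier := {x | ∃ c : ℤ, c ≠ 0 ∧ c • x ∈ W}
  zero_mem' := ⟨1, one_ne_zero, by simp⟩
  add_mem' := by
    rintro x y ⟨c, hc, hx⟩ ⟨d, hd, hy⟩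
    refine ⟨c * d, mul_ne_zero hc hd, ?_⟩
    have : (c * d) • (x + y) = d • c • x + c • d • y := by
      simp only [smul_add, smul_smul, mul_comm]
    rw [this]
    exact W.add_mem (W.smul_mem _ hx) (W.smul_mem _ hy)
  smul_mem' := by
    rintro a x ⟨c, hc, hx⟩
    exact ⟨c, hc, by rw [smul_comm]; exact W.smul_mem _ hx⟩

theorem le_saturation {M : Type*} [AddCommGroup M] (W : Submodule ℤ M) : W ≤ saturation W :=
  fun x hx => ⟨1, one_ne_zero, by simpa using hx⟩

theorem sat_saturation {M : Type*} [AddCommGroup M] (W : Submodule ℤ M) : Sat (saturation W) := by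
  rintro c hc x ⟨d, hd, hx⟩
  exact ⟨d * c, mul_ne_zero hd hc, by rwa [mul_smul]⟩

theorem finrank_eq_of_smul_mem {M : Type*} [AddCommGroup M] [IsNoetherian ℤ M]
    {A B : Submodule ℤ M} (h : A ≤ B) (hs : ∀ x ∈ B, ∃ c : ℤ, c ≠ 0 ∧ c • x ∈ A) :
    Module.finrank ℤ A = Module.finrank ℤ B := by
  have h1 := (A.comap B.subtype).finrank_quotient_add_finrank
  have h2 : Module.finrank ℤ (B ⧸ A.comap B.subtype) = 0 := by
    rw [Module.finrank_eq_zero_iff]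
    intro x
    obtain ⟨y, rfl⟩ := Submodule.Quotient.mk_surjective _ x
    obtain ⟨c, hc, hy⟩ := hs y y.2
    refine ⟨c, hc, ?_⟩
    rw [← Submodule.Quotient.mk_smul, Submodule.Quotient.mk_eq_zero]
    exact hy
  have h3 : Module.finrank ℤ (A.comap B.subtype) = Module.finrank ℤ A :=
    (Submodule.comapSubtypeEquivOfLe h).finrank_eq
  omega

/-- Equal ranks make the quotient `B / A` a torsion group. -/
theorem exists_smul_mem_of_finrank_eq {M : Type*} [AddCommGroup M] [IsNoetherian ℤ M]
    {A B : Submodule ℤ M} (h : A ≤ B) (hr : Module.finrank ℤ A = Module.finrank ℤ B) :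
    ∀ x ∈ B, ∃ c : ℤ, c ≠ 0 ∧ c • x ∈ A := by
  have h1 := (A.comap B.subtype).finrank_quotient_add_finrank
  have h3 : Module.finrank ℤ (A.comap B.subtype) = Module.finrank ℤ A :=
    (Submodule.comapSubtypeEquivOfLe h).finrank_eq
  have h2 : Module.finrank ℤ (B ⧸ A.comap B.subtype) = 0 := by omega
  rw [Module.finrank_eq_zero_iff] at h2
  intro x hx
  obtain ⟨c, hc, hy⟩ := h2 (Submodule.Quotient.mk ⟨x, hx⟩)
  refine ⟨c, hc, ?_⟩
  rw [← Submodule.Quotient.mk_smul, Submodule.Quotient.mk_eq_zero] at hy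
  exact hy

theorem finrank_saturation {M : Type*} [AddCommGroup M] [IsNoetherian ℤ M] (W : Submodule ℤ M) :
    Module.finrank ℤ (saturation W) = Module.finrank ℤ W :=
  (finrank_eq_of_smul_mem (le_saturation W) fun _ hx => hx).symm

theorem finrank_sup_add_finrank_inf {M : Type*} [AddCommGroup M] [IsNoetherian ℤ M]
    (A B : Submodule ℤ M) :
    Module.finrank ℤ (A ⊔ B : Submodule ℤ M) + Module.finrank ℤ (A ⊓ B : Submodule ℤ M)
      = Module.finrank ℤ A + Module.finrank ℤ B := by
  have h := Submodule.rank_sup_add_rank_inf_eq A B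
  simp only [← Module.finrank_eq_rank] at h
  exact_mod_cast h

theorem finrank_map_add_finrank_inf_ker {M M' : Type*} [AddCommGroup M] [IsNoetherian ℤ M]
    [AddCommGroup M'] [IsNoetherian ℤ M'] (f : M →ₗ[ℤ] M') (A : Submodule ℤ M) :
    Module.finrank ℤ (A.map f) + Module.finrank ℤ (A ⊓ LinearMap.ker f : Submodule ℤ M)
      = Module.finrank ℤ A := by
  have h1 := (LinearMap.ker (f.domRestrict A)).finrank_quotient_add_finrank
  have h2 := (f.domRestrict A).quotKerEquivRange.finrank_eq
  have h3 : LinearMap.range (f.domRestrict A) = A.map f := by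
    rw [LinearMap.domRestrict, LinearMap.range_comp, Submodule.range_subtype]
  have h4 : Module.finrank ℤ (LinearMap.ker (f.domRestrict A))
      = Module.finrank ℤ (A ⊓ LinearMap.ker f : Submodule ℤ M) := by
    have h5 : LinearMap.ker (f.domRestrict A) = (A ⊓ LinearMap.ker f).comap A.subtype := by
      ext x
      simp
    rw [h5]
    exact (Submodule.comapSubtypeEquivOfLe inf_le_left).finrank_eq
  rw [h3] at h2
  omega

/-- An integer vector orthogonal to itself is zero, so `Aᵀ * A` has the same kernel as `A` and hence
the same rank. The transpose matters because `Matrix.rank` is defined by column vectors while the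
groups here act on rows. -/
theorem rank_le_rank_transpose_int {ι κ : Type*} [Fintype ι] [Fintype κ] (A : Matrix ι κ ℤ) :
    A.rank ≤ Aᵀ.rank := by
  have hker : LinearMap.ker (Aᵀ * A).mulVecLin = LinearMap.ker A.mulVecLin := by
    ext x
    simp only [LinearMap.mem_ker, mulVecLin_apply, ← mulVec_mulVec]
    constructor
    · intro h
      replace h := congr_arg (dotProduct x) h
      rwa [dotProduct_mulVec, dotProduct_zero, vecMul_transpose, dotProduct_self_eq_zero] at h
    · intro h
      rw [h, mulVec_zero]
  have h1 := finrank_map_add_finrank_inf_ker A.mulVecLin ⊤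
  have h2 := finrank_map_add_finrank_inf_ker (Aᵀ * A).mulVecLin ⊤
  rw [hker] at h2
  have h3 : (Aᵀ * A).rank = A.rank := by
    rw [Matrix.rank, Matrix.rank, LinearMap.range_eq_map, LinearMap.range_eq_map]
    omega
  rw [← h3]
  exact rank_mul_le_left _ _

theorem rank_transpose_int {ι κ : Type*} [Fintype ι] [Fintype κ] (A : Matrix ι κ ℤ) :
    Aᵀ.rank = A.rank :=
  le_antisymm (rank_le_rank_transpose_int Aᵀ) (rank_le_rank_transpose_int A)

/-! ### Row vectors and the symplectic form -/

/-- Row vectors of length `2n`. -/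
abbrev Vec (n : ℕ) : Type := Fin n ⊕ Fin n → ℤ

/-- The symplectic form on row vectors. -/
def om {n : ℕ} (x y : Vec n) : ℤ :=
  ∑ j, (x (Sum.inr j) * y (Sum.inl j) - x (Sum.inl j) * y (Sum.inr j))

theorem om_eq_dotProduct {n : ℕ} (x y : Vec n) :
    om x y = x ⬝ᵥ (Matrix.J (Fin n) ℤ *ᵥ y) := by
  simp [om, dotProduct, Matrix.J, fromBlocks_mulVec, neg_mulVec, sub_eq_neg_add,
    Finset.sum_add_distrib]

theorem om_add_left {n : ℕ} (x y z : Vec n) : om (x + y) z = om x z + om y z := by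
  simp [om_eq_dotProduct]

theorem om_add_right {n : ℕ} (x y z : Vec n) : om x (y + z) = om x y + om x z := by
  simp [om_eq_dotProduct, mulVec_add]

theorem om_smul_left {n : ℕ} (c : ℤ) (x y : Vec n) : om (c • x) y = c * om x y := by
  simp only [om_eq_dotProduct, smul_dotProduct, smul_eq_mul]

theorem om_smul_right {n : ℕ} (c : ℤ) (x y : Vec n) : om x (c • y) = c * om x y := by
  simp only [om_eq_dotProduct, mulVec_smul, dotProduct_smul, smul_eq_mul]

theorem om_neg_right {n : ℕ} (x y : Vec n) : om x (-y) = -om x y := by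
  simp [om_eq_dotProduct, mulVec_neg]

theorem om_sub_right {n : ℕ} (x y z : Vec n) : om x (y - z) = om x y - om x z := by
  rw [sub_eq_add_neg, om_add_right, om_neg_right, sub_eq_add_neg]

theorem om_swap {n : ℕ} (x y : Vec n) : om x y = -om y x := by
  simp only [om, ← Finset.sum_neg_distrib]
  exact Finset.sum_congr rfl fun j _ => by ring

theorem om_self {n : ℕ} (x : Vec n) : om x x = 0 := by
  have := om_swap x x
  omega

theorem om_single_inr {n : ℕ} (x : Vec n) (j : Fin n) :
    om x (Pi.single (Sum.inr j) 1) = -x (Sum.inl j) := by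
  simp [om, Pi.single_apply]

theorem om_single_inl {n : ℕ} (x : Vec n) (j : Fin n) :
    om x (Pi.single (Sum.inl j) 1) = x (Sum.inr j) := by
  simp [om, Pi.single_apply]

/-- The right action of the symplectic group on row vectors. -/
def act {n : ℕ} (g : Sp n) : Vec n ≃ₗ[ℤ] Vec n where
  toFun x := x ᵥ* g.1
  invFun x := x ᵥ* (g⁻¹).1
  map_add' x y := add_vecMul _ _ _
  map_smul' c x := smul_vecMul _ _ _
  left_inv x := by
    have h : g.1 * (g⁻¹).1 = 1 := congrArg Subtype.val (mul_inv_cancel g)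
    simp only [vecMul_vecMul, h, vecMul_one]
  right_inv x := by
    have h : (g⁻¹).1 * g.1 = 1 := congrArg Subtype.val (inv_mul_cancel g)
    simp only [vecMul_vecMul, h, vecMul_one]

theorem act_apply {n : ℕ} (g : Sp n) (x : Vec n) : act g x = x ᵥ* g.1 := rfl

theorem act_mul {n : ℕ} (g h : Sp n) (x : Vec n) : act (g * h) x = act h (act g x) :=
  (vecMul_vecMul x g.1 h.1).symm

theorem act_one {n : ℕ} (x : Vec n) : act (1 : Sp n) x = x := vecMul_one x

theorem act_inv_act {n : ℕ} (g : Sp n) (x : Vec n) : act g⁻¹ (act g x) = x :=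
  (act g).left_inv x

theorem act_act_inv {n : ℕ} (g : Sp n) (x : Vec n) : act g (act g⁻¹ x) = x :=
  (act g).right_inv x

theorem act_single {n : ℕ} (g : Sp n) (i j : Fin n ⊕ Fin n) :
    act g (Pi.single i 1) j = g.1 i j := by
  simp [act_apply]

theorem om_act {n : ℕ} (g : Sp n) (x y : Vec n) : om (act g x) (act g y) = om x y := by
  have h := SymplecticGroup.mem_iff.1 g.2
  rw [om_eq_dotProduct, om_eq_dotProduct, act_apply, act_apply, ← mulVec_transpose g.1 y,
    ← dotProduct_mulVec, mulVec_mulVec, mulVec_mulVec, h]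

/-- Bijectivity of `f` need not be assumed: preservation of the form is the whole membership
condition of the symplectic group. -/
theorem exists_act_eq_of_isometry {n : ℕ} (f : Vec n →ₗ[ℤ] Vec n)
    (h : ∀ x y, om (f x) (f y) = om x y) : ∃ g : Sp n, ∀ x, act g x = f x := by
  have hf : ∀ x, x ᵥ* (LinearMap.toMatrix' f)ᵀ = f x := fun x => by
    rw [vecMul_transpose, LinearMap.toMatrix'_mulVec]
  refine ⟨⟨(LinearMap.toMatrix' f)ᵀ, ?_⟩, hf⟩
  rw [SymplecticGroup.mem_iff]
  have h1 : ∀ x y : Vec n, x ⬝ᵥ (((LinearMap.toMatrix' f)ᵀ * Matrix.J (Fin n) ℤ *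
      (LinearMap.toMatrix' f)ᵀᵀ) *ᵥ y) = x ⬝ᵥ (Matrix.J (Fin n) ℤ *ᵥ y) := by
    intro x y
    rw [← om_eq_dotProduct, ← h, om_eq_dotProduct, ← hf x, ← hf y, ← dotProduct_mulVec,
      ← mulVec_transpose _ y, mulVec_mulVec, mulVec_mulVec]
  ext i j
  have h2 := h1 (Pi.single i 1) (Pi.single j 1)
  simpa only [single_one_dotProduct, mulVec_single_one, Matrix.col_apply] using h2

/-- The subgroup `W g` of row vectors. -/
def img {n : ℕ} (W : Submodule ℤ (Vec n)) (g : Sp n) : Submodule ℤ (Vec n) :=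
  W.comap (act g⁻¹).toLinearMap

theorem mem_img {n : ℕ} {W : Submodule ℤ (Vec n)} {g : Sp n} {x : Vec n} :
    x ∈ img W g ↔ act g⁻¹ x ∈ W := Iff.rfl

theorem act_mem_img {n : ℕ} {W : Submodule ℤ (Vec n)} {g : Sp n} {x : Vec n} :
    act g x ∈ img W g ↔ x ∈ W := by
  rw [mem_img, act_inv_act]

theorem img_mul {n : ℕ} (W : Submodule ℤ (Vec n)) (g h : Sp n) :
    img W (g * h) = img (img W g) h := by
  ext x
  rw [mem_img, mem_img, mem_img, _root_.mul_inv_rev, act_mul]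

theorem img_one {n : ℕ} (W : Submodule ℤ (Vec n)) : img W 1 = W := by
  ext x
  simp only [mem_img, inv_one, act_one]

theorem img_inv_eq {n : ℕ} {W W' : Submodule ℤ (Vec n)} {g : Sp n} :
    img W g⁻¹ = W' ↔ W = img W' g := by
  constructor
  · rintro rfl
    rw [← img_mul, inv_mul_cancel, img_one]
  · rintro rfl
    rw [← img_mul, mul_inv_cancel, img_one]

theorem img_inf {n : ℕ} (W W' : Submodule ℤ (Vec n)) (g : Sp n) :
    img (W ⊓ W') g = img W g ⊓ img W' g := rfl

theorem img_mono {n : ℕ} {W W' : Submodule ℤ (Vec n)} (h : W ≤ W') (g : Sp n) :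
    img W g ≤ img W' g := fun _ hx => h hx

theorem img_injective {n : ℕ} {W W' : Submodule ℤ (Vec n)} {g : Sp n}
    (h : img W g = img W' g) : W = W' := by
  rw [← img_inv_eq] at h
  rwa [← img_mul, mul_inv_cancel, img_one] at h

theorem finrank_img {n : ℕ} (W : Submodule ℤ (Vec n)) (g : Sp n) :
    Module.finrank ℤ (img W g) = Module.finrank ℤ W :=
  finrank_comap_equiv _ _

theorem Sat.img {n : ℕ} {W : Submodule ℤ (Vec n)} (h : Sat W) (g : Sp n) : Sat (img W g) :=
  h.comap _

/-- A subgroup of `ℤ^{2n}` is isotropic if the symplectic form vanishes on it. -/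
def Iso {n : ℕ} (W : Submodule ℤ (Vec n)) : Prop := ∀ x ∈ W, ∀ y ∈ W, om x y = 0

theorem Iso.img {n : ℕ} {W : Submodule ℤ (Vec n)} (h : Iso W) (g : Sp n) : Iso (img W g) :=
  fun x hx y hy => by
    rw [← om_act g⁻¹]
    exact h _ hx _ hy

theorem img_eq_self_of_forall {n : ℕ} {W : Submodule ℤ (Vec n)} {g : Sp n}
    (h : ∀ x ∈ W, act g x ∈ W) : img W g = W := by
  have h1 : W.comap (act g).toLinearMap = W := comap_eq_of_le_comap _ h
  have h2 : img W g⁻¹ = W := by simpa only [img, inv_inv] using h1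
  exact (img_inv_eq.1 h2).symm

/-! ### The standard isotropic subgroups -/

/-- The row vectors supported on the last `n - m` coordinates. -/
def F (n m : ℕ) : Submodule ℤ (Vec n) where
  carrier := {x | (∀ j, x (Sum.inl j) = 0) ∧ ∀ j : Fin n, (j : ℕ) < m → x (Sum.inr j) = 0}
  zero_mem' := by simp
  add_mem' := fun {x y} hx hy =>
    ⟨fun j => by simp [hx.1 j, hy.1 j], fun j hj => by simp [hx.2 j hj, hy.2 j hj]⟩
  smul_mem' := fun c x hx => ⟨fun j => by simp [hx.1 j], fun j hj => by simp [hx.2 j hj]⟩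

/-- The orthogonal complement of `F n r`. -/
def P (n r : ℕ) : Submodule ℤ (Vec n) where
  carrier := {x | ∀ j : Fin n, r ≤ (j : ℕ) → x (Sum.inl j) = 0}
  zero_mem' := by simp
  add_mem' := fun {x y} hx hy j hj => by simp [hx j hj, hy j hj]
  smul_mem' := fun c x hx j hj => by simp [hx j hj]

theorem mem_P {n r : ℕ} {x : Vec n} : x ∈ P n r ↔
    ∀ j : Fin n, r ≤ (j : ℕ) → x (Sum.inl j) = 0 := Iff.rfl

theorem single_mem_F {n m : ℕ} {j : Fin n} (h : m ≤ (j : ℕ)) :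
    Pi.single (Sum.inr j) 1 ∈ F n m := by
  refine ⟨fun i => by simp, fun i hi => ?_⟩
  rw [Pi.single_apply, if_neg]
  intro h'
  cases h'
  omega

theorem mem_P_iff_om {n r : ℕ} {x : Vec n} : x ∈ P n r ↔ ∀ y ∈ F n r, om x y = 0 := by
  constructor
  · intro hx y hy
    refine Finset.sum_eq_zero fun j _ => ?_
    rw [hy.1 j]
    rcases lt_or_ge (j : ℕ) r with h | h
    · rw [hy.2 j h]; simp
    · rw [hx j h]; simp
  · intro h j hj
    have := h _ (single_mem_F hj)
    rw [om_single_inr] at this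
    omega

theorem F_le_P (n m r : ℕ) : F n m ≤ P n r := fun _ hx j _ => hx.1 j

theorem F_le_F {n m r : ℕ} (h : r ≤ m) : F n m ≤ F n r :=
  fun _ hx => ⟨hx.1, fun j hj => hx.2 j (by omega)⟩

theorem sat_F (n m : ℕ) : Sat (F n m) := by
  intro c hc x hx
  refine ⟨fun j => ?_, fun j hj => ?_⟩
  · simpa [hc] using hx.1 j
  · simpa [hc] using hx.2 j hj

theorem sat_P (n m : ℕ) : Sat (P n m) := by
  intro c hc x hx j hj
  simpa [hc] using hx j hj

theorem iso_F (n m : ℕ) : Iso (F n m) := fun _ hx _ hy => mem_P_iff_om.1 (F_le_P n m m hx) _ hy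

/-- The inclusion of the row vectors supported on the last coordinates. -/
def inclF (n m : ℕ) : ({i : Fin n // m ≤ (i : ℕ)} → ℤ) →ₗ[ℤ] Vec n where
  toFun x := Sum.elim 0 fun j => if h : m ≤ (j : ℕ) then x ⟨j, h⟩ else 0
  map_add' x y := by
    ext (j | j)
    · simp
    · by_cases h : m ≤ (j : ℕ) <;> simp [h]
  map_smul' c x := by
    ext (j | j)
    · simp
    · by_cases h : m ≤ (j : ℕ) <;> simp [h]

theorem inclF_injective (n m : ℕ) : Function.Injective (inclF n m) := by
  intro x y h
  ext ⟨j, hj⟩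
  have := congrFun h (Sum.inr j)
  simpa [inclF, hj] using this

theorem range_inclF (n m : ℕ) : LinearMap.range (inclF n m) = F n m := by
  ext x
  constructor
  · rintro ⟨y, rfl⟩
    refine ⟨fun j => by simp [inclF], fun j hj => ?_⟩
    simp [inclF, not_le.2 hj]
  · intro hx
    refine ⟨fun j => x (Sum.inr j.1), ?_⟩
    ext (j | j)
    · simp [inclF, hx.1 j]
    · by_cases h : m ≤ (j : ℕ)
      · simp [inclF, h]
      · simp [inclF, h, hx.2 j (not_le.1 h)]

theorem card_le_val (n m : ℕ) : Fintype.card {i : Fin n // m ≤ (i : ℕ)} = n - m := by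
  have h : Fintype.card {i : Fin n // ¬ (i : ℕ) < m} = n - Fintype.card {i : Fin n // (i : ℕ) < m} := by
    rw [Fintype.card_subtype_compl, Fintype.card_fin]
  simp only [not_lt] at h
  rw [h, Fintype.card_subtype, Fin.card_filter_val_lt]
  omega

theorem finrank_F (n m : ℕ) : Module.finrank ℤ (F n m) = n - m := by
  rw [← range_inclF, LinearMap.finrank_range_of_inj (inclF_injective n m), Module.finrank_pi,
    card_le_val]

theorem F_eq_bot {n m : ℕ} (h : n ≤ m) : F n m = ⊥ := by
  rw [eq_bot_iff]
  intro x hx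
  rw [Submodule.mem_bot]
  ext (j | j)
  · exact hx.1 j
  · exact hx.2 j (by omega)

theorem mem_C_iff {n m : ℕ} {g : Sp n} : g ∈ C n m ↔ ∀ x ∈ F n m, act g x ∈ F n m := by
  constructor
  · intro hg x hx
    refine ⟨fun j => ?_, fun j hj => ?_⟩
    · rw [act_apply, vecMul, dotProduct, Fintype.sum_sum_type]
      rw [Finset.sum_eq_zero, Finset.sum_eq_zero, add_zero]
      · intro i _
        rcases lt_or_ge (i : ℕ) m with h | h
        · rw [hx.2 i h, zero_mul]
        · rw [hg.1 i j h, mul_zero]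
      · intro i _
        rw [hx.1 i, zero_mul]
    · rw [act_apply, vecMul, dotProduct, Fintype.sum_sum_type]
      rw [Finset.sum_eq_zero, Finset.sum_eq_zero, add_zero]
      · intro i _
        rcases lt_or_ge (i : ℕ) m with h | h
        · rw [hx.2 i h, zero_mul]
        · rw [hg.2 i j h hj, mul_zero]
      · intro i _
        rw [hx.1 i, zero_mul]
  · intro h
    refine ⟨fun i j hi => ?_, fun i j hi hj => ?_⟩
    · rw [← act_single]
      exact (h _ (single_mem_F hi)).1 j
    · rw [← act_single]
      exact (h _ (single_mem_F hi)).2 j hj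

theorem img_F_of_mem_C {n m : ℕ} {g : Sp n} (hg : g ∈ C n m) : img (F n m) g = F n m :=
  img_eq_self_of_forall (mem_C_iff.1 hg)

/-- This turns statements about cosets into statements about subgroups of `ℤ^{2n}`. -/
theorem exists_mem_C_mul_iff {n m : ℕ} {g g' : Sp n} :
    (∃ h ∈ C n m, g = h * g') ↔ img (F n m) g = img (F n m) g' := by
  constructor
  · rintro ⟨h, hh, rfl⟩
    rw [img_mul, img_F_of_mem_C hh]
  · intro h
    refine ⟨g * g'⁻¹, mem_C_iff.2 fun x hx => ?_, by group⟩
    have h1 : img (F n m) (g * g'⁻¹) = F n m := by rw [img_mul, img_inv_eq, h]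
    rw [← h1]
    exact act_mem_img.2 hx

theorem act_eq_self_of_mem_J {n r : ℕ} {g : Sp n} (hg : g ∈ J n r) {x : Vec n} (hx : x ∈ F n r) :
    act g x = x := by
  have h1 : ∀ i j, x i * g.1 i j = x i * (1 : Matrix (Fin n ⊕ Fin n) (Fin n ⊕ Fin n) ℤ) i j := by
    rintro (i | i) j
    · rw [hx.1 i, zero_mul, zero_mul]
    · rcases lt_or_ge (i : ℕ) r with h | h
      · rw [hx.2 i h, zero_mul, zero_mul]
      · congr 1
        rcases j with j | j
        · rw [hg.1.1 i j h]; simp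
        · rcases lt_or_ge (j : ℕ) r with h' | h'
          · rw [hg.1.2 i j h h', Matrix.one_apply_ne]
            intro hij
            cases hij
            omega
          · rw [hg.2 i j h h', Matrix.one_apply]
            simp
  ext j
  rw [act_apply, vecMul, dotProduct, Finset.sum_congr rfl fun i _ => h1 i j]
  exact congrFun (vecMul_one x) j

theorem mem_J_iff {n r : ℕ} {g : Sp n} : g ∈ J n r ↔ ∀ x ∈ F n r, act g x = x := by
  refine ⟨fun hg x hx => act_eq_self_of_mem_J hg hx, fun h => ⟨⟨?_, ?_⟩, ?_⟩⟩
  · intro i j hi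
    rw [← act_single, h _ (single_mem_F hi)]
    simp
  · intro i j hi hj
    rw [← act_single, h _ (single_mem_F hi)]
    exact (single_mem_F hi).2 j hj
  · intro i j hi hj
    rw [← act_single, h _ (single_mem_F hi)]
    simp [Pi.single_apply, eq_comm]

theorem one_mem_J (n r : ℕ) : (1 : Sp n) ∈ J n r := mem_J_iff.2 fun x _ => act_one x

theorem mul_mem_J {n r : ℕ} {g h : Sp n} (hg : g ∈ J n r) (hh : h ∈ J n r) : g * h ∈ J n r := by
  rw [mem_J_iff] at *
  intro x hx
  rw [act_mul, hg x hx, hh x hx]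

theorem inv_mem_J {n r : ℕ} {g : Sp n} (hg : g ∈ J n r) : g⁻¹ ∈ J n r := by
  rw [mem_J_iff] at *
  intro x hx
  nth_rewrite 1 [← hg x hx]
  exact act_inv_act g x

theorem img_F_of_mem_J {n r k : ℕ} {g : Sp n} (hg : g ∈ J n r) (hk : r ≤ k) :
    img (F n k) g = F n k := by
  ext x
  constructor
  · intro hx
    have := mem_J_iff.1 hg _ (F_le_F hk (mem_img.1 hx))
    rw [act_act_inv] at this
    rw [this]
    exact hx
  · intro hx
    rw [mem_img, mem_J_iff.1 (inv_mem_J hg) x (F_le_F hk hx)]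
    exact hx

theorem img_P_of_img_F {n r : ℕ} {g : Sp n} (h : img (F n r) g = F n r) :
    img (P n r) g = P n r := by
  ext x
  rw [mem_img, mem_P_iff_om, mem_P_iff_om]
  constructor
  · intro h1 y hy
    rw [← h] at hy
    have := h1 (act g⁻¹ y) hy
    rwa [om_act] at this
  · intro h1 y hy
    rw [← om_act g, act_act_inv]
    apply h1
    rw [← h]
    exact act_mem_img.2 hy

/-! ### The action of padded matrices -/

theorem vecMul_pad {k off n : ℕ} (h : off + k ≤ n) (e : ℤ) (A : Matrix (Fin k) (Fin k) ℤ)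
    (x : Fin n → ℤ) (j : Fin n) :
    (x ᵥ* pad off n e A) j = if hj : off ≤ (j : ℕ) ∧ (j : ℕ) < off + k then
      ((fun a : Fin k => x ⟨off + a, by omega⟩) ᵥ* A) ⟨(j : ℕ) - off, by omega⟩
      else e * x j := by
  rw [vecMul, dotProduct]
  split_ifs with hj
  · let f : Fin k → Fin n := fun a => ⟨off + a, by omega⟩
    have hf : Function.Injective f := by
      intro a b hab
      have := congrArg Fin.val hab
      simp only [f] at this
      exact Fin.ext (by omega)
    rw [vecMul, dotProduct]
    refine (Fintype.sum_of_injective f hf _ _ ?_ ?_).symm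
    · intro l hl
      have hl' : ¬ (off ≤ (l : ℕ) ∧ (l : ℕ) < off + k) := by
        rintro ⟨h1, h2⟩
        exact hl ⟨⟨(l : ℕ) - off, by omega⟩, Fin.ext (by simp only [f]; omega)⟩
      have hlj : l ≠ j := by rintro rfl; exact hl' hj
      simp [pad, hl', hlj]
    · intro a
      simp [pad, hj, f]
  · rw [Finset.sum_eq_single j]
    · simp only [pad, Matrix.of_apply, hj, and_false, dite_false, if_true, mul_comm]
    · intro l _ hl
      simp only [pad, Matrix.of_apply, hj, and_false, dite_false, if_neg hl, mul_zero]
    · simp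

/-- The projection of row vectors forgetting the coordinates from `k` on in both halves. -/
def res {n k : ℕ} (h : k ≤ n) : Vec n →ₗ[ℤ] Vec k where
  toFun x := x ∘ Sum.map (Fin.castLE h) (Fin.castLE h)
  map_add' _ _ := rfl
  map_smul' _ _ := rfl

theorem res_inl {n k : ℕ} (h : k ≤ n) (x : Vec n) (j : Fin k) :
    res h x (Sum.inl j) = x (Sum.inl (Fin.castLE h j)) := rfl

theorem res_inr {n k : ℕ} (h : k ≤ n) (x : Vec n) (j : Fin k) :
    res h x (Sum.inr j) = x (Sum.inr (Fin.castLE h j)) := rfl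

/-- Extension of row vectors by zero. -/
def ext (n : ℕ) {k : ℕ} : Vec k →ₗ[ℤ] Vec n where
  toFun x := Sum.elim (fun j => if h : (j : ℕ) < k then x (Sum.inl ⟨j, h⟩) else 0)
    (fun j => if h : (j : ℕ) < k then x (Sum.inr ⟨j, h⟩) else 0)
  map_add' x y := by
    ext (j | j) <;> by_cases h : (j : ℕ) < k <;> simp [h]
  map_smul' c x := by
    ext (j | j) <;> by_cases h : (j : ℕ) < k <;> simp [h]

theorem ext_inl (n : ℕ) {k : ℕ} (x : Vec k) (j : Fin n) :
    ext n x (Sum.inl j) = if h : (j : ℕ) < k then x (Sum.inl ⟨j, h⟩) else 0 := rfl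

theorem res_ext {n k : ℕ} (h : k ≤ n) (x : Vec k) : res h (ext n x) = x := by
  ext (j | j) <;> simp [res, ext]

theorem ext_mem_P {n k : ℕ} (x : Vec k) : ext n x ∈ P n k := fun j hj => by
  simp [ext_inl, not_lt.2 hj]

theorem mem_F_iff_res {n k : ℕ} (h : k ≤ n) {x : Vec n} :
    x ∈ F n k ↔ x ∈ P n k ∧ res h x = 0 := by
  constructor
  · intro hx
    refine ⟨F_le_P n k k hx, ?_⟩
    ext (j | j)
    · exact hx.1 _
    · exact hx.2 _ (by simp)
  · rintro ⟨h1, h2⟩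
    refine ⟨fun j => ?_, fun j hj => ?_⟩
    · rcases lt_or_ge (j : ℕ) k with h' | h'
      · exact congrFun h2 (Sum.inl ⟨j, h'⟩)
      · exact h1 j h'
    · exact congrFun h2 (Sum.inr ⟨j, hj⟩)

theorem res_eq_zero_of_mem_F {n k : ℕ} (h : k ≤ n) {x : Vec n} (hx : x ∈ F n k) : res h x = 0 :=
  ((mem_F_iff_res h).1 hx).2

/-- On `P n k` the form only sees the first `k` coordinates of each half, so it descends to the
quotient by `F n k`, which is `ℤ^{2k}`. -/
theorem om_res {n k : ℕ} (h : k ≤ n) {x y : Vec n} (hx : x ∈ P n k) (hy : y ∈ P n k) :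
    om (res h x) (res h y) = om x y := by
  refine Fintype.sum_of_injective (Fin.castLE h) (Fin.castLE_injective h) _ _ ?_ ?_
  · intro j hj
    have hj' : k ≤ (j : ℕ) := by
      by_contra h'
      exact hj ⟨⟨j, by omega⟩, rfl⟩
    rw [hx j hj', hy j hj']
    simp
  · intro j
    rfl

theorem up_val {n k : ℕ} (h : k ≤ n) (g : Sp k) : (up n g).1 = upMatrix n g.1 := by
  rw [up, dif_pos h]
  rfl

theorem act_up_inl {n k : ℕ} (h : k ≤ n) (g : Sp k) (x : Vec n) (j : Fin n) :
    act (up n g) x (Sum.inl j) =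
      if hj : (j : ℕ) < k then act g (res h x) (Sum.inl ⟨j, hj⟩) else x (Sum.inl j) := by
  rw [act_apply, act_apply, up_val h, upMatrix, vecMul_fromBlocks, Sum.elim_inl, Pi.add_apply,
    vecMul_pad (by omega), vecMul_pad (by omega)]
  split_ifs with h1 h2 h2
  · conv_rhs => rw [← fromBlocks_toBlocks g.1]
    rw [vecMul_fromBlocks, Sum.elim_inl, Pi.add_apply]
    congr 3 <;> ext a <;> simp [res, Fin.castLE]
  · omega
  · omega
  · simp

theorem act_up_inr {n k : ℕ} (h : k ≤ n) (g : Sp k) (x : Vec n) (j : Fin n) :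
    act (up n g) x (Sum.inr j) =
      if hj : (j : ℕ) < k then act g (res h x) (Sum.inr ⟨j, hj⟩) else x (Sum.inr j) := by
  rw [act_apply, act_apply, up_val h, upMatrix, vecMul_fromBlocks, Sum.elim_inr, Pi.add_apply,
    vecMul_pad (by omega), vecMul_pad (by omega)]
  split_ifs with h1 h2 h2
  · conv_rhs => rw [← fromBlocks_toBlocks g.1]
    rw [vecMul_fromBlocks, Sum.elim_inr, Pi.add_apply]
    congr 3 <;> ext a <;> simp [res, Fin.castLE]
  · omega
  · omega
  · simp

theorem res_act_up {n k : ℕ} (h : k ≤ n) (g : Sp k) (x : Vec n) :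
    res h (act (up n g) x) = act g (res h x) := by
  ext (j | j)
  · rw [res_inl, act_up_inl h, dif_pos (by simp)]
    rfl
  · rw [res_inr, act_up_inr h, dif_pos (by simp)]
    rfl

theorem act_up_mem_P {n k : ℕ} (h : k ≤ n) (g : Sp k) {x : Vec n} :
    act (up n g) x ∈ P n k ↔ x ∈ P n k := by
  rw [mem_P, mem_P]
  refine forall₂_congr fun j hj => ?_
  rw [act_up_inl h, dif_neg (by omega)]

/-- The preimage of a subgroup `W` of `ℤ^{2k}` under the projection of `P n k` onto `ℤ^{2k}`. -/
def Up {n k : ℕ} (h : k ≤ n) (W : Submodule ℤ (Vec k)) : Submodule ℤ (Vec n) :=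
  P n k ⊓ W.comap (res h)

theorem mem_Up {n k : ℕ} {h : k ≤ n} {W : Submodule ℤ (Vec k)} {x : Vec n} :
    x ∈ Up h W ↔ x ∈ P n k ∧ res h x ∈ W := Iff.rfl

theorem img_Up {n k : ℕ} (h : k ≤ n) (W : Submodule ℤ (Vec k)) (g : Sp k) :
    img (Up h W) (up n g) = Up h (img W g) := by
  ext x
  rw [mem_img, mem_Up, mem_Up, mem_img, ← map_inv, act_up_mem_P h, res_act_up]

theorem ext_mem_Up {n k : ℕ} {h : k ≤ n} {W : Submodule ℤ (Vec k)} {x : Vec k} :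
    ext n x ∈ Up h W ↔ x ∈ W := by
  rw [mem_Up, res_ext]
  exact ⟨fun hx => hx.2, fun hx => ⟨ext_mem_P x, hx⟩⟩

theorem Up_injective {n k : ℕ} {h : k ≤ n} {W W' : Submodule ℤ (Vec k)} (he : Up h W = Up h W') :
    W = W' := by
  ext x
  rw [← ext_mem_Up (h := h), he, ext_mem_Up]

theorem F_le_Up {n k : ℕ} (h : k ≤ n) (W : Submodule ℤ (Vec k)) : F n k ≤ Up h W := by
  intro x hx
  refine ⟨F_le_P n k k hx, ?_⟩
  change res h x ∈ W
  rw [res_eq_zero_of_mem_F h hx]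
  exact W.zero_mem

theorem Up_F {n k m : ℕ} (h : k ≤ n) (hm : m ≤ k) : Up h (F k m) = F n m := by
  ext x
  constructor
  · rintro ⟨h1, h2, h3⟩
    refine ⟨fun j => ?_, fun j hj => ?_⟩
    · rcases lt_or_ge (j : ℕ) k with h' | h'
      · exact h2 ⟨j, h'⟩
      · exact h1 j h'
    · exact h3 ⟨j, by omega⟩ hj
  · intro hx
    exact ⟨F_le_P n m k hx, fun j => hx.1 _, fun j hj => hx.2 _ hj⟩

theorem res_mem_P {n k r : ℕ} (h : k ≤ n) {x : Vec n} (hx : x ∈ P n r) : res h x ∈ P k r :=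
  fun j hj => hx (Fin.castLE h j) hj

theorem res_mem_F {n k r : ℕ} (h : k ≤ n) {x : Vec n} (hx : x ∈ F n r) : res h x ∈ F k r :=
  ⟨fun _ => hx.1 _, fun j hj => hx.2 (Fin.castLE h j) hj⟩

/-- Isotropy and `F n k ≤ W` force `W` into the orthogonal complement `P n k`; a subgroup between `F
n k` and `P n k` is determined by its image in the quotient `ℤ^{2k}`. -/
theorem eq_Up_comap_ext {n k : ℕ} (h : k ≤ n) {W : Submodule ℤ (Vec n)} (hW : Iso W)
    (hF : F n k ≤ W) : W = Up h (W.comap (ext n)) := by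
  have hP : ∀ x ∈ W, x ∈ P n k := fun x hx => mem_P_iff_om.2 fun y hy => hW x hx y (hF hy)
  have hd : ∀ x ∈ P n k, x - ext n (res h x) ∈ F n k := by
    intro x hx
    rw [mem_F_iff_res h, map_sub, res_ext, sub_self]
    exact ⟨(P n k).sub_mem hx (ext_mem_P _), rfl⟩
  ext x
  rw [mem_Up, Submodule.mem_comap]
  constructor
  · intro hx
    refine ⟨hP x hx, ?_⟩
    have := W.sub_mem hx (hF (hd x (hP x hx)))
    rwa [sub_sub_cancel] at this
  · rintro ⟨h1, h2⟩
    have := W.add_mem (hF (hd x h1)) h2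
    rwa [sub_add_cancel] at this

theorem Iso.comap_ext {n k : ℕ} (h : k ≤ n) {W : Submodule ℤ (Vec n)} (hW : Iso W) :
    Iso (W.comap (ext n : Vec k →ₗ[ℤ] Vec n)) := by
  intro x hx y hy
  rw [← res_ext h x, ← res_ext h y, om_res h (ext_mem_P x) (ext_mem_P y)]
  exact hW _ hx _ hy

theorem res_res {n k r : ℕ} (hk : k ≤ n) (hr : r ≤ k) (x : Vec n) :
    res hr (res hk x) = res (hr.trans hk) x := by
  ext (j | j) <;> rfl

theorem up_up {n k r : ℕ} (hk : k ≤ n) (hr : r ≤ k) (g : Sp r) : up n (up k g) = up n g := by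
  refine Subtype.ext ?_
  have : ∀ x, act (up n (up k g)) x = act (up n g) x := by
    intro x
    ext (j | j)
    · rw [act_up_inl hk, act_up_inl (hr.trans hk)]
      split_ifs with h1 h2 h2
      · rw [act_up_inl hr, dif_pos h2, res_res]
      · rw [act_up_inl hr, dif_neg h2]
        rfl
      · omega
      · rfl
    · rw [act_up_inr hk, act_up_inr (hr.trans hk)]
      split_ifs with h1 h2 h2
      · rw [act_up_inr hr, dif_pos h2, res_res]
      · rw [act_up_inr hr, dif_neg h2]
        rfl
      · omega
      · rfl
  ext i j
  rw [← act_single, ← act_single, this]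

/-! ### Transitivity on primitive isotropic subgroups -/

theorem exists_transvection {n : ℕ} (v : Vec n) (c : ℤ) :
    ∃ g : Sp n, ∀ x, act g x = x + (c * om x v) • v := by
  refine exists_act_eq_of_isometry
    { toFun := fun x => x + (c * om x v) • v
      map_add' := fun x y => by rw [om_add_left, mul_add, add_smul]; abel
      map_smul' := fun a x => by
        rw [om_smul_left, RingHom.id_apply, smul_add, smul_smul]
        congr 2
        ring } fun x y => ?_
  simp only [LinearMap.coe_mk, AddHom.coe_mk, om_add_left, om_add_right, om_smul_left,
    om_smul_right, om_self]
  rw [om_swap v y]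
  ring

/-- The transvection along `y - x` with coefficient `c` moves `x` by exactly `y - x`. -/
theorem exists_act_eq_of_om_eq {n : ℕ} {x y : Vec n} {c : ℤ} (hc : c * om x y = 1) :
    ∃ g : Sp n, act g x = y := by
  obtain ⟨g, hg⟩ := exists_transvection (y - x) c
  refine ⟨g, ?_⟩
  rw [hg, om_sub_right, om_self, sub_zero, hc, one_smul, add_sub_cancel]

theorem exists_act_om_ne_zero {n : ℕ} {w v e f : Vec n} (hwv : om w v = 1) (hef : om f e = 1) :
    ∃ g : Sp n, om (act g w) e ≠ 0 := by
  by_cases hwe : om w e = 0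
  · obtain ⟨z, hz1, hz2⟩ : ∃ z, om w z ≠ 0 ∧ om z e ≠ 0 := by
      by_cases hve : om v e = 0
      · by_cases hwf : 1 + om w f = 0
        · refine ⟨v - f, ?_, ?_⟩
          · rw [om_sub_right]; omega
          · rw [sub_eq_add_neg, om_add_left, om_swap (-f), om_neg_right, om_swap e f]; omega
        · refine ⟨v + f, ?_, ?_⟩
          · rw [om_add_right]; omega
          · rw [om_add_left]; omega
      · exact ⟨v, by omega, hve⟩
    obtain ⟨g, hg⟩ := exists_transvection z 1
    refine ⟨g, ?_⟩
    rw [hg, om_add_left, om_smul_left, hwe, zero_add, one_mul]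
    exact mul_ne_zero hz1 hz2
  · exact ⟨1, by rwa [act_one]⟩

/-- Euclidean descent: choose `x` in the orbit of `w` with `|om x e|` positive and minimal.
Minimality makes `om x e` divide all pairings of `x`, and one of them is `1` because `w` is
primitive. So `om x e` is a unit, and `x` can be moved to `e` and then to `f`. -/
theorem exists_act_eq_of_primitive {n : ℕ} {w v e f : Vec n} (hwv : om w v = 1)
    (hef : om f e = 1) : ∃ g : Sp n, act g w = f := by
  classical
  have hex : ∃ d : ℕ, 0 < d ∧ ∃ g : Sp n, (om (act g w) e).natAbs = d := by
    obtain ⟨g, hg⟩ := exists_act_om_ne_zero hwv hef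
    exact ⟨_, Int.natAbs_pos.2 hg, g, rfl⟩
  obtain ⟨hd0, g, hg⟩ := Nat.find_spec hex
  have hmin : ∀ g' : Sp n, om (act g' w) e ≠ 0 →
      (Nat.find hex) ≤ (om (act g' w) e).natAbs := fun g' h =>
    Nat.find_min' hex ⟨Int.natAbs_pos.2 h, g', rfl⟩
  generalize Nat.find hex = d at hd0 hg hmin
  set x := act g w with hx
  have hxe : om x e ≠ 0 := by
    intro h
    rw [h] at hg
    simp at hg
    omega
  -- A transvection along `e` reduces `om x z` modulo `om x e` without changing `om x e`; one along
  -- `z` then adds any multiple of the remainder to `om x e`.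
  have key : ∀ z, om z e = 1 → om x e ∣ om x z := by
    intro z hz
    obtain ⟨g1, hg1⟩ := exists_transvection e (om x z / om x e)
    have hze : om e z = -1 := by rw [om_swap, hz]
    have h1 : om (act g1 x) z = om x z % om x e := by
      rw [hg1, om_add_left, om_smul_left, hze, Int.emod_def]
      ring
    have h2 : om (act g1 x) e = om x e := by
      rw [hg1, om_add_left, om_smul_left, om_self]
      ring
    by_contra hnd
    have h3 : om x z % om x e ≠ 0 := fun h => hnd (Int.dvd_of_emod_eq_zero h)
    have h4 : 0 ≤ om x z % om x e := Int.emod_nonneg _ hxe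
    have h5 : om x z % om x e < |om x e| := Int.emod_lt_abs _ hxe
    have h6 : ∀ c : ℤ, om x e + c * (om x z % om x e) ≠ 0 →
        |om x e| ≤ |om x e + c * (om x z % om x e)| := by
      intro c hc
      obtain ⟨g2, hg2⟩ := exists_transvection z c
      have h7 : om (act (g * g1 * g2) w) e = om x e + c * (om x z % om x e) := by
        rw [act_mul, act_mul, ← hx, hg2, om_add_left, om_smul_left, h1, h2, hz]
        ring
      have := hmin (g * g1 * g2) (by rwa [h7])
      rw [h7, ← hg] at this
      rw [Int.abs_eq_natAbs, Int.abs_eq_natAbs]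
      exact_mod_cast this
    -- A nonzero remainder `b` satisfies `0 < b < |om x e|`. Reducing `om x e` modulo `b` must give
    -- `0` by minimality; stopping one step earlier leaves `b` itself, which is nonzero and too
    -- small.
    generalize hb : om x z % om x e = b at *
    have h7 := Int.emod_nonneg (om x e) h3
    have h8 := Int.emod_lt_of_pos (om x e) (show 0 < b by omega)
    have h9 := h6 (-(om x e / b))
    have h10 : om x e + -(om x e / b) * b = om x e % b := by rw [Int.emod_def]; ring
    rw [h10, abs_of_nonneg h7] at h9
    have h11 : om x e % b = 0 := by
      by_contra h
      have := h9 h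
      omega
    have h12 := h6 (1 - om x e / b)
    have h13 : om x e + (1 - om x e / b) * b = b := by
      have := Int.emod_def (om x e) b
      rw [h11] at this
      linear_combination -this
    rw [h13, abs_of_nonneg h4] at h12
    have := h12 h3
    omega
  have key2 : ∀ z, om x e ∣ om x z := by
    intro z
    -- Subtracting this multiple of `f` makes the pairing with `e` equal to `1`, so that `key`
    -- applies.
    have h1 := key (z - (om z e - 1) • f) (by
      rw [sub_eq_add_neg, om_add_left, ← neg_smul, om_smul_left, hef]; ring)
    have h2 := key f hef
    rw [om_sub_right, om_smul_right] at h1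
    have := dvd_add h1 (Dvd.dvd.mul_left h2 (om z e - 1))
    rwa [sub_add_cancel] at this
  have h1 : om x e ∣ 1 := by
    rw [← hwv, ← om_act g w v, ← hx]
    exact key2 _
  obtain ⟨c, hc⟩ := h1
  obtain ⟨g1, hg1⟩ := exists_act_eq_of_om_eq (x := x) (y := e) (c := c) (by rw [hc]; ring)
  obtain ⟨g2, hg2⟩ := exists_act_eq_of_om_eq (x := e) (y := f) (c := -1) (by
    rw [om_swap, hef]; ring)
  exact ⟨g * g1 * g2, by rw [act_mul, act_mul, ← hx, hg1, hg2]⟩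

/-- Take `c` to generate the ideal of all pairings of `w`. It divides every coordinate of `w`, since
up to sign the coordinates are pairings with basis vectors. -/
theorem exists_primitive_smul {n : ℕ} {w : Vec n} (hw : w ≠ 0) :
    ∃ (c : ℤ) (w' v : Vec n), c ≠ 0 ∧ w = c • w' ∧ om w' v = 1 := by
  let φ : Vec n →ₗ[ℤ] ℤ :=
    { toFun := fun v => om w v
      map_add' := fun x y => om_add_right w x y
      map_smul' := fun a x => om_smul_right a w x }
  obtain ⟨c, hc⟩ := (IsPrincipalIdealRing.principal (LinearMap.range φ)).principal
  have hmem : ∀ v, c ∣ om w v := by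
    intro v
    have : om w v ∈ LinearMap.range φ := ⟨v, rfl⟩
    rw [hc] at this
    exact Ideal.mem_span_singleton.1 this
  obtain ⟨v, hv⟩ : ∃ v, om w v = c := by
    have : c ∈ LinearMap.range φ := by
      rw [hc]
      exact Submodule.mem_span_singleton_self c
    exact this
  have hdvd : ∀ i, c ∣ w i := by
    rintro (j | j)
    · have := hmem (Pi.single (Sum.inr j) 1)
      rwa [om_single_inr, dvd_neg] at this
    · have := hmem (Pi.single (Sum.inl j) 1)
      rwa [om_single_inl] at this
  choose w' hw' using hdvd
  have hww : w = c • w' := funext hw'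
  have hc0 : c ≠ 0 := by
    rintro rfl
    exact hw (by rw [hww, zero_smul])
  refine ⟨c, w', v, hc0, hww, ?_⟩
  rw [hww, om_smul_left] at hv
  exact mul_left_cancel₀ hc0 (by rw [hv, mul_one])

/-- Induction on `n`: a nonzero saturated `W` contains a primitive vector, which can be moved to the
last basis vector. The translate then contains `F (n + 1) n`, so it is pulled back from a saturated
isotropic subgroup of `ℤ^{2n}`. -/
theorem exists_img_F_eq {n : ℕ} {W : Submodule ℤ (Vec n)} (hs : Sat W) (hi : Iso W) :
    ∃ m ≤ n, ∃ g : Sp n, W = img (F n m) g := by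
  induction n with
  | zero =>
    refine ⟨0, le_rfl, 1, ?_⟩
    ext x
    rw [Subsingleton.elim x 0]
    simp
  | succ n ih =>
    by_cases hW : W = ⊥
    · exact ⟨n + 1, le_rfl, 1, by rw [hW, img_one, F_eq_bot le_rfl]⟩
    obtain ⟨w, hw, hw0⟩ := W.exists_mem_ne_zero_of_ne_bot hW
    obtain ⟨c, w', v, hc, rfl, hv⟩ := exists_primitive_smul hw0
    have hw' : w' ∈ W := hs c hc w' hw
    obtain ⟨g, hg⟩ := exists_act_eq_of_primitive (e := Pi.single (Sum.inl (Fin.last n)) 1)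
      (f := Pi.single (Sum.inr (Fin.last n)) 1) hv (by rw [om_single_inl]; simp)
    have hF : F (n + 1) n ≤ img W g := by
      intro x hx
      have hx' : x = x (Sum.inr (Fin.last n)) • act g w' := by
        rw [hg]
        ext (j | j)
        · simp [hx.1 j]
        · rcases Fin.lt_or_eq_of_le (Fin.le_last j) with h | h
          · rw [hx.2 j h]
            simp [h.ne]
          · simp [h]
      rw [hx']
      exact Submodule.smul_mem _ _ (act_mem_img.2 hw')
    have hle : n ≤ n + 1 := Nat.le_succ n
    have h1 := eq_Up_comap_ext hle (hi.img g) hF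
    obtain ⟨m, hm, g1, hg1⟩ := ih ((hs.img g).comap (ext (n + 1))) ((hi.img g).comap_ext hle)
    rw [hg1, ← img_Up, Up_F _ hm] at h1
    refine ⟨m, by omega, up (n + 1) g1 * g⁻¹, ?_⟩
    rw [img_mul, ← h1, ← img_mul, mul_inv_cancel, img_one]

theorem finrank_img_F_inj {n m m' : ℕ} {g : Sp n} {W : Submodule ℤ (Vec n)} (hm : m ≤ n)
    (hm' : m' ≤ n) (h : W = img (F n m) g) (hr : Module.finrank ℤ W = n - m') : m = m' := by
  rw [h, finrank_img, finrank_F] at hr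
  omega

/-! ### The general linear group -/

/-- The right action of `GL_N(ℤ)` on row vectors. -/
def gact {N : ℕ} (u : GLZ N) : (Fin N → ℤ) ≃ₗ[ℤ] (Fin N → ℤ) where
  toFun x := x ᵥ* u.1
  invFun x := x ᵥ* (u⁻¹).1
  map_add' x y := add_vecMul _ _ _
  map_smul' c x := smul_vecMul _ _ _
  left_inv x := by
    have h : u.1 * (u⁻¹).1 = 1 := u.mul_inv
    simp only [vecMul_vecMul, h, vecMul_one]
  right_inv x := by
    have h : (u⁻¹).1 * u.1 = 1 := u.inv_mul
    simp only [vecMul_vecMul, h, vecMul_one]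

theorem gact_apply {N : ℕ} (u : GLZ N) (x : Fin N → ℤ) : gact u x = x ᵥ* u.1 := rfl

theorem gact_mul {N : ℕ} (u v : GLZ N) (x : Fin N → ℤ) :
    gact (u * v) x = gact v (gact u x) :=
  (vecMul_vecMul x u.1 v.1).symm

theorem gact_one {N : ℕ} (x : Fin N → ℤ) : gact (1 : GLZ N) x = x := vecMul_one x

theorem gact_inv_gact {N : ℕ} (u : GLZ N) (x : Fin N → ℤ) : gact u⁻¹ (gact u x) = x :=
  (gact u).left_inv x

theorem gact_gact_inv {N : ℕ} (u : GLZ N) (x : Fin N → ℤ) : gact u (gact u⁻¹ x) = x :=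
  (gact u).right_inv x

theorem gact_single {N : ℕ} (u : GLZ N) (i j : Fin N) : gact u (Pi.single i 1) j = u.1 i j := by
  simp [gact_apply]

/-- The subgroup `W u` of row vectors. -/
def gimg {N : ℕ} (W : Submodule ℤ (Fin N → ℤ)) (u : GLZ N) : Submodule ℤ (Fin N → ℤ) :=
  W.comap (gact u⁻¹).toLinearMap

theorem mem_gimg {N : ℕ} {W : Submodule ℤ (Fin N → ℤ)} {u : GLZ N} {x : Fin N → ℤ} :
    x ∈ gimg W u ↔ gact u⁻¹ x ∈ W := Iff.rfl

theorem gact_mem_gimg {N : ℕ} {W : Submodule ℤ (Fin N → ℤ)} {u : GLZ N} {x : Fin N → ℤ} :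
    gact u x ∈ gimg W u ↔ x ∈ W := by
  rw [mem_gimg, gact_inv_gact]

theorem gimg_mul {N : ℕ} (W : Submodule ℤ (Fin N → ℤ)) (u v : GLZ N) :
    gimg W (u * v) = gimg (gimg W u) v := by
  ext x
  rw [mem_gimg, mem_gimg, mem_gimg, _root_.mul_inv_rev, gact_mul]

theorem gimg_one {N : ℕ} (W : Submodule ℤ (Fin N → ℤ)) : gimg W 1 = W := by
  ext x
  rw [mem_gimg, inv_one, gact_one]

theorem gimg_inv_eq {N : ℕ} {W W' : Submodule ℤ (Fin N → ℤ)} {u : GLZ N} :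
    gimg W u⁻¹ = W' ↔ W = gimg W' u := by
  constructor
  · rintro rfl
    rw [← gimg_mul, inv_mul_cancel, gimg_one]
  · rintro rfl
    rw [← gimg_mul, mul_inv_cancel, gimg_one]

theorem gimg_eq_self_of_forall {N : ℕ} {W : Submodule ℤ (Fin N → ℤ)} {u : GLZ N}
    (h : ∀ x ∈ W, gact u x ∈ W) : gimg W u = W := by
  have h1 : W.comap (gact u).toLinearMap = W := comap_eq_of_le_comap _ h
  have h2 : gimg W u⁻¹ = W := by simpa only [gimg, inv_inv] using h1
  exact (gimg_inv_eq.1 h2).symm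

/-- The row vectors supported on the last `N - a` coordinates. -/
def E (N a : ℕ) : Submodule ℤ (Fin N → ℤ) where
  carrier := {x | ∀ j : Fin N, (j : ℕ) < a → x j = 0}
  zero_mem' := by simp
  add_mem' := fun {x y} hx hy j hj => by simp [hx j hj, hy j hj]
  smul_mem' := fun c x hx j hj => by simp [hx j hj]

theorem mem_E {N a : ℕ} {x : Fin N → ℤ} : x ∈ E N a ↔ ∀ j : Fin N, (j : ℕ) < a → x j = 0 :=
  Iff.rfl

theorem single_mem_E {N a : ℕ} {j : Fin N} (h : a ≤ (j : ℕ)) : Pi.single j 1 ∈ E N a := by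
  intro i hi
  rw [Pi.single_apply, if_neg]
  rintro rfl
  omega

theorem mem_parabolicGL_iff {N a : ℕ} {u : GLZ N} :
    u ∈ parabolicGL N a ↔ ∀ x ∈ E N a, gact u x ∈ E N a := by
  constructor
  · intro hu x hx j hj
    rw [gact_apply, vecMul, dotProduct]
    refine Finset.sum_eq_zero fun i _ => ?_
    rcases lt_or_ge (i : ℕ) a with h | h
    · rw [hx i h, zero_mul]
    · rw [hu i j h hj, mul_zero]
  · intro h i j hi hj
    rw [← gact_single]
    exact h _ (single_mem_E hi) j hj

theorem exists_mem_parabolicGL_mul_iff {N a : ℕ} {u v : GLZ N} :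
    (∃ h ∈ parabolicGL N a, u = h * v) ↔ gimg (E N a) u = gimg (E N a) v := by
  constructor
  · rintro ⟨h, hh, rfl⟩
    rw [gimg_mul, gimg_eq_self_of_forall (mem_parabolicGL_iff.1 hh)]
  · intro h
    refine ⟨u * v⁻¹, mem_parabolicGL_iff.2 fun x hx => ?_, by group⟩
    have h1 : gimg (E N a) (u * v⁻¹) = E N a := by rw [gimg_mul, gimg_inv_eq, h]
    rw [← h1]
    exact gact_mem_gimg.2 hx

theorem L_val {n : ℕ} (U : GLZ n) : (L U).1 = fromBlocks (U⁻¹).1ᵀ 0 0 U.1 := rfl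

theorem preimage_L_C (N a : ℕ) : L ⁻¹' C N a = parabolicGL N a := by
  ext u
  simp [C, parabolicGL, L_val]

theorem mem_preimage_L_J_iff {N a : ℕ} {u : GLZ N} :
    u ∈ L ⁻¹' J N a ↔ ∀ x ∈ E N a, gact u x = x := by
  rw [Set.mem_preimage, mem_J_iff]
  constructor
  · intro h x hx
    have := h (Sum.elim 0 x) ⟨fun j => rfl, hx⟩
    rw [act_apply, L_val, vecMul_fromBlocks] at this
    ext j
    have := congrFun this (Sum.inr j)
    rw [gact_apply]
    simpa using this
  · intro h x hx
    have h1 := h (x ∘ Sum.inr) hx.2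
    have h2 : x ∘ Sum.inl = 0 := funext hx.1
    rw [act_apply, L_val, vecMul_fromBlocks]
    rw [gact_apply] at h1
    rw [h1, h2]
    ext (j | j)
    · simp [hx.1 j]
    · simp

/-- In Smith normal form, saturation allows the invariant factors to be dropped, so `W` is spanned
by part of a basis of `ℤ^N`. Ordering that part last, the basis vectors are the rows of `u`. -/
theorem exists_gimg_E_eq {N : ℕ} {W : Submodule ℤ (Fin N → ℤ)} (hs : Sat W) :
    ∃ a ≤ N, ∃ u : GLZ N, W = gimg (E N a) u := by
  classical
  obtain ⟨k, snf⟩ := Submodule.smithNormalForm (Pi.basisFun ℤ (Fin N)) W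
  have hk : k ≤ N := by
    simpa using Fintype.card_le_of_injective _ snf.f.injective
  have hspan : ∀ x, x ∈ W ↔ ∀ i, i ∉ Set.range snf.f → snf.bM.repr x i = 0 := by
    intro x
    constructor
    · intro hx i hi
      exact snf.repr_eq_zero_of_notMem_range ⟨x, hx⟩ hi
    · intro h
      rw [← snf.bM.sum_repr x]
      refine W.sum_mem fun i _ => ?_
      by_cases hi : i ∈ Set.range snf.f
      · obtain ⟨j, rfl⟩ := hi
        refine W.smul_mem _ (hs (snf.a j) ?_ _ ?_)
        · intro ha
          have := snf.snf j
          rw [ha, zero_smul] at this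
          exact snf.bN.ne_zero j (Subtype.ext this)
        · rw [← snf.snf j]
          exact (snf.bN j).2
      · rw [h i hi, zero_smul]
        exact W.zero_mem
  have hcard : Fintype.card {i : Fin N // N - k ≤ (i : ℕ)}
      = Fintype.card {i // i ∈ Set.range snf.f} := by
    rw [card_le_val, ← Fintype.card_congr (Equiv.ofInjective _ snf.f.injective), Fintype.card_fin]
    omega
  let σ : Equiv.Perm (Fin N) := (Fintype.equivOfCardEq hcard).extendSubtype
  have hσ : ∀ i : Fin N, σ i ∈ Set.range snf.f ↔ N - k ≤ (i : ℕ) := by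
    intro i
    constructor
    · intro h
      by_contra h'
      exact (Fintype.equivOfCardEq hcard).extendSubtype_not_mem i h' h
    · exact fun h => (Fintype.equivOfCardEq hcard).extendSubtype_mem i h
  let b := snf.bM.reindex σ.symm
  let A : Matrix (Fin N) (Fin N) ℤ := ((Pi.basisFun ℤ (Fin N)).toMatrix b)ᵀ
  let B : Matrix (Fin N) (Fin N) ℤ := (b.toMatrix (Pi.basisFun ℤ (Fin N)))ᵀ
  have hAB : A * B = 1 := by
    rw [← transpose_mul, b.toMatrix_mul_toMatrix_flip, transpose_one]
  have hBA : B * A = 1 := by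
    rw [← transpose_mul, Module.Basis.toMatrix_mul_toMatrix_flip, transpose_one]
  refine ⟨N - k, Nat.sub_le _ _, ⟨A, B, hAB, hBA⟩, ?_⟩
  ext x
  have hx : gact (⟨A, B, hAB, hBA⟩ : GLZ N)⁻¹ x = b.repr x := by
    change x ᵥ* B = _
    rw [vecMul_transpose]
    have h1 := Module.Basis.toMatrix_mulVec_repr (Pi.basisFun ℤ (Fin N)) b x
    have h2 : ⇑((Pi.basisFun ℤ (Fin N)).repr x) = x := by
      ext j
      exact Pi.basisFun_repr ..
    rwa [h2] at h1
  rw [mem_gimg, hx, hspan, mem_E]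
  constructor
  · intro h j hj
    have h1 : b.repr x j = snf.bM.repr x (σ j) := by simp [b]
    rw [h1]
    exact h _ fun h2 => by
      have := (hσ j).1 h2
      omega
  · intro h i hi
    have h1 : snf.bM.repr x i = b.repr x (σ.symm i) := by simp [b]
    rw [h1]
    apply h
    by_contra h2
    apply hi
    have := (hσ (σ.symm i)).2 (by omega)
    rwa [Equiv.apply_symm_apply] at this

/-- The inclusion of the row vectors supported on the last coordinates. -/
def inclE (N a : ℕ) : ({i : Fin N // a ≤ (i : ℕ)} → ℤ) →ₗ[ℤ] (Fin N → ℤ) where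
  toFun x := fun j => if h : a ≤ (j : ℕ) then x ⟨j, h⟩ else 0
  map_add' x y := by
    ext j
    by_cases h : a ≤ (j : ℕ) <;> simp [h]
  map_smul' c x := by
    ext j
    by_cases h : a ≤ (j : ℕ) <;> simp [h]

theorem inclE_injective (N a : ℕ) : Function.Injective (inclE N a) := by
  intro x y h
  ext ⟨j, hj⟩
  have := congrFun h j
  simpa [inclE, hj] using this

theorem inclE_mem (N a : ℕ) (x : {i : Fin N // a ≤ (i : ℕ)} → ℤ) : inclE N a x ∈ E N a := by
  intro j hj
  simp [inclE, not_le.2 hj]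

theorem exists_inclE_eq {N a : ℕ} {x : Fin N → ℤ} (hx : x ∈ E N a) :
    ∃ y, inclE N a y = x := by
  refine ⟨fun j => x j.1, ?_⟩
  ext j
  by_cases h : a ≤ (j : ℕ)
  · simp [inclE, h]
  · simp [inclE, h, hx j (not_le.1 h)]

theorem vecMul_submatrix_eq {ι N a : ℕ} (A : Matrix (Fin N) (Fin ι) ℤ)
    (x : {i : Fin N // a ≤ (i : ℕ)} → ℤ) {κ : Type*} (f : κ → Fin ι) (j : κ) :
    (x ᵥ* A.submatrix (fun i : {i : Fin N // a ≤ (i : ℕ)} => i.1) f) j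
      = (inclE N a x ᵥ* A) (f j) := by
  rw [vecMul, vecMul, dotProduct, dotProduct]
  refine Fintype.sum_of_injective Subtype.val Subtype.val_injective _ _ ?_ ?_
  · intro i hi
    have : ¬ a ≤ (i : ℕ) := fun h => hi ⟨⟨i, h⟩, rfl⟩
    simp [inclE, this]
  · rintro ⟨i, hi⟩
    simp [inclE, hi]

/-- A relation between the rows of the corner block is a combination of the last `κ` rows of `u`
whose first `κ` coordinates vanish; full rank means that there are no nontrivial ones. -/
theorem mem_GLstar_iff {N κ : ℕ} (hκ : κ ≤ N) {u : GLZ N} :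
    u ∈ GLstar N κ ↔ gimg (E N (N - κ)) u ⊓ E N κ = ⊥ := by
  rw [GLstar, Set.mem_ofPred_eq, ← rank_transpose_int, Matrix.rank, LinearMap.range_eq_map]
  set f := (u.1.submatrix (fun i : {i : Fin N // N - κ ≤ (i : ℕ)} => i.1)
    (fun j : {j : Fin N // (j : ℕ) < κ} => j.1))ᵀ.mulVecLin with hf
  have h1 := finrank_map_add_finrank_inf_ker f ⊤
  rw [top_inf_eq, finrank_top, Module.finrank_pi, card_le_val] at h1
  have hmem : ∀ x, x ∈ LinearMap.ker f ↔ gact u (inclE N (N - κ) x) ∈ E N κ := by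
    intro x
    rw [LinearMap.mem_ker, hf, mulVecLin_apply, mulVec_transpose, funext_iff]
    simp only [vecMul_submatrix_eq, Pi.zero_apply]
    exact ⟨fun h j hj => h ⟨j, hj⟩, fun h j => h j.1 j.2⟩
  have h2 : Module.finrank ℤ (LinearMap.ker f) = 0 ↔ gimg (E N (N - κ)) u ⊓ E N κ = ⊥ := by
    rw [Submodule.finrank_eq_zero, eq_bot_iff, eq_bot_iff]
    constructor
    · rintro h x ⟨hx1, hx2⟩
      obtain ⟨y, hy⟩ := exists_inclE_eq (mem_gimg.1 hx1)
      have h3 : gact u (inclE N (N - κ) y) = x := by rw [hy, gact_gact_inv]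
      have h4 : y = 0 := h ((hmem y).2 (by rwa [h3]))
      rw [Submodule.mem_bot, ← h3, h4, map_zero, map_zero]
    · intro h x hx
      have h3 : gact u (inclE N (N - κ) x) = 0 :=
        h ⟨gact_mem_gimg.2 (inclE_mem _ _ _), (hmem x).1 hx⟩
      rw [LinearEquiv.map_eq_zero_iff] at h3
      exact inclE_injective _ _ (by rw [h3, map_zero])
  rw [← h2]
  omega

/-! ### Subgroups of row vectors supported on the second half -/

/-- The slice of the second half of a row vector given by the coordinates `off, …, off + N - 1`. -/
def slice {off N n : ℕ} (h : off + N ≤ n) : Vec n →ₗ[ℤ] (Fin N → ℤ) where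
  toFun x a := x (Sum.inr ⟨off + a, by omega⟩)
  map_add' _ _ := rfl
  map_smul' _ _ := rfl

/-- The preimage in `F n off` of a subgroup of `ℤ^N`. -/
def G {off N n : ℕ} (h : off + N ≤ n) (W : Submodule ℤ (Fin N → ℤ)) : Submodule ℤ (Vec n) :=
  F n off ⊓ W.comap (slice h)

theorem mem_G {off N n : ℕ} {h : off + N ≤ n} {W : Submodule ℤ (Fin N → ℤ)} {x : Vec n} :
    x ∈ G h W ↔ x ∈ F n off ∧ slice h x ∈ W := Iff.rfl

/-- The inclusion of `ℤ^N` into the row vectors, as the given slice of the second half. -/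
def spread (off n : ℕ) {N : ℕ} : (Fin N → ℤ) →ₗ[ℤ] Vec n where
  toFun x := Sum.elim 0 fun j =>
    if h : off ≤ (j : ℕ) ∧ (j : ℕ) < off + N then x ⟨(j : ℕ) - off, by omega⟩ else 0
  map_add' x y := by
    ext (j | j)
    · simp
    · by_cases h : off ≤ (j : ℕ) ∧ (j : ℕ) < off + N <;> simp [h]
  map_smul' c x := by
    ext (j | j)
    · simp
    · by_cases h : off ≤ (j : ℕ) ∧ (j : ℕ) < off + N <;> simp [h]

theorem spread_mem_F {off N n : ℕ} (x : Fin N → ℤ) : spread off n x ∈ F n off := by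
  refine ⟨fun j => rfl, fun j hj => ?_⟩
  simp [spread, not_le.2 hj]

theorem slice_spread {off N n : ℕ} (h : off + N ≤ n) (x : Fin N → ℤ) :
    slice h (spread off n x) = x := by
  ext a
  simp [slice, spread]

theorem spread_mem_G {off N n : ℕ} {h : off + N ≤ n} {W : Submodule ℤ (Fin N → ℤ)}
    {x : Fin N → ℤ} : spread off n x ∈ G h W ↔ x ∈ W := by
  rw [mem_G, slice_spread]
  exact ⟨fun hx => hx.2, fun hx => ⟨spread_mem_F x, hx⟩⟩

theorem G_injective {off N n : ℕ} {h : off + N ≤ n} {W W' : Submodule ℤ (Fin N → ℤ)}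
    (he : G h W = G h W') : W = W' := by
  ext x
  rw [← spread_mem_G (h := h), he, spread_mem_G]

theorem G_inf {off N n : ℕ} (h : off + N ≤ n) (W W' : Submodule ℤ (Fin N → ℤ)) :
    G h (W ⊓ W') = G h W ⊓ G h W' := by
  ext x
  rw [Submodule.mem_inf, mem_G, mem_G, mem_G, Submodule.mem_inf]
  tauto

theorem G_E {off N n a : ℕ} (h : off + N ≤ n) (ha : a ≤ N) : G h (E N a) = F n (off + a) := by
  ext x
  constructor
  · rintro ⟨h1, h2⟩
    refine ⟨h1.1, fun j hj => ?_⟩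
    rcases lt_or_ge (j : ℕ) off with h3 | h3
    · exact h1.2 j h3
    · have := h2 ⟨(j : ℕ) - off, by omega⟩ (by simp only; omega)
      simpa [slice, h3] using this
  · rintro ⟨h1, h2⟩
    exact ⟨⟨h1, fun j hj => h2 j (by omega)⟩, fun j hj => h2 _ (by simp only; omega)⟩

theorem G_bot {off N n : ℕ} (h : off + N ≤ n) : G h ⊥ = F n (off + N) := by
  rw [← G_E h le_rfl]
  congr 1
  rw [eq_comm, eq_bot_iff]
  intro x hx
  exact funext fun j => hx j j.2

theorem eq_G_comap_spread {off N n : ℕ} (h : off + N ≤ n) {W : Submodule ℤ (Vec n)}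
    (h1 : F n (off + N) ≤ W) (h2 : W ≤ F n off) : W = G h (W.comap (spread off n)) := by
  have hd : ∀ x ∈ F n off, x - spread off n (slice h x) ∈ F n (off + N) := by
    intro x hx
    rw [← G_bot h, mem_G, map_sub, slice_spread, sub_self]
    exact ⟨(F n off).sub_mem hx (spread_mem_F _), rfl⟩
  ext x
  rw [mem_G, Submodule.mem_comap]
  constructor
  · intro hx
    refine ⟨h2 hx, ?_⟩
    have := W.sub_mem hx (h1 (hd x (h2 hx)))
    rwa [sub_sub_cancel] at this
  · rintro ⟨h3, h4⟩
    have := W.add_mem (h1 (hd x h3)) h4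
    rwa [sub_add_cancel] at this

theorem blockGL_val {off N n : ℕ} (h : off + N ≤ n) (u : GLZ N) :
    (blockGL off n u).1 = pad off n 1 u.1 := by
  rw [blockGL, dif_pos h]
  rfl

theorem act_L_inr {n : ℕ} (U : GLZ n) (x : Vec n) (j : Fin n) :
    act (L U) x (Sum.inr j) = ((x ∘ Sum.inr) ᵥ* U.1) j := by
  rw [act_apply, L_val, vecMul_fromBlocks]
  simp

theorem act_L_inl {n : ℕ} (U : GLZ n) (x : Vec n) (j : Fin n) :
    act (L U) x (Sum.inl j) = ((x ∘ Sum.inl) ᵥ* (U⁻¹).1ᵀ) j := by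
  rw [act_apply, L_val, vecMul_fromBlocks]
  simp

theorem act_L_blockGL_inr {off N n : ℕ} (h : off + N ≤ n) (u : GLZ N) (x : Vec n) (j : Fin n) :
    act (L (blockGL off n u)) x (Sum.inr j) =
      if hj : off ≤ (j : ℕ) ∧ (j : ℕ) < off + N then gact u (slice h x) ⟨(j : ℕ) - off, by omega⟩
      else x (Sum.inr j) := by
  rw [act_L_inr, blockGL_val h, vecMul_pad h]
  simp only [one_mul]
  rfl

theorem act_L_blockGL_inl_eq_zero {off N n : ℕ} (u : GLZ N) {x : Vec n}
    (hx : ∀ j, x (Sum.inl j) = 0) (j : Fin n) :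
    act (L (blockGL off n u)) x (Sum.inl j) = 0 := by
  have h1 : x ∘ Sum.inl = 0 := funext hx
  rw [act_L_inl, h1, zero_vecMul, Pi.zero_apply]

theorem slice_act_L {off N n : ℕ} (h : off + N ≤ n) (u : GLZ N) (x : Vec n) :
    slice h (act (L (blockGL off n u)) x) = gact u (slice h x) := by
  ext a
  change act (L (blockGL off n u)) x (Sum.inr _) = _
  rw [act_L_blockGL_inr h, dif_pos ⟨by simp, by simp⟩]
  exact congrArg (gact u (slice h x)) (Fin.ext (by simp))

theorem act_L_blockGL_mem_F {off N n : ℕ} (h : off + N ≤ n) (u : GLZ N) {x : Vec n}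
    (hx : x ∈ F n off) : act (L (blockGL off n u)) x ∈ F n off := by
  refine ⟨act_L_blockGL_inl_eq_zero u hx.1, fun j hj => ?_⟩
  rw [act_L_blockGL_inr h, dif_neg (by omega), hx.2 j hj]

theorem img_F_L_blockGL {off N n : ℕ} (h : off + N ≤ n) (u : GLZ N) :
    img (F n off) (L (blockGL off n u)) = F n off :=
  img_eq_self_of_forall fun _ hx => act_L_blockGL_mem_F h u hx

theorem img_G {off N n : ℕ} (h : off + N ≤ n) (W : Submodule ℤ (Fin N → ℤ)) (u : GLZ N) :
    img (G h W) (L (blockGL off n u)) = G h (gimg W u) := by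
  ext x
  rw [mem_img, mem_G, mem_G, mem_gimg, ← map_inv, ← map_inv, slice_act_L, map_inv, map_inv,
    ← mem_img, img_F_L_blockGL h]

theorem up_L_blockGL {off N k n : ℕ} (hk : k ≤ n) (h : off + N ≤ k) (u : GLZ N) :
    up n (L (blockGL off k u)) = L (blockGL off n u) := by
  refine Subtype.ext ?_
  have hp : ∀ A : Matrix (Fin N) (Fin N) ℤ, pad 0 n 1 (pad off k 1 A) = pad off n 1 A := by
    intro A
    ext i j
    simp only [pad, Matrix.of_apply, Fin.ext_iff, Nat.sub_zero, Nat.zero_le, true_and, Nat.zero_add]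
    split_ifs <;> first | rfl | omega
  have hinv : ∀ (n : ℕ) (h : off + N ≤ n), ((blockGL off n u)⁻¹).1 = pad off n 1 (u⁻¹).1 := by
    intro n h
    rw [← map_inv, blockGL_val h]
  rw [up_val hk, L_val, L_val, upMatrix, hinv k h, hinv n (h.trans hk), blockGL_val h,
    blockGL_val (h.trans hk), toBlocks_fromBlocks₁₁, toBlocks_fromBlocks₁₂, toBlocks_fromBlocks₂₁,
    toBlocks_fromBlocks₂₂, pad_zero, hp, pad_transpose, hp, ← pad_transpose]

/-! ### The rank condition -/

theorem finrank_map_of_injective {M M' : Type*} [AddCommGroup M] [AddCommGroup M']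
    {f : M →ₗ[ℤ] M'} (hf : Function.Injective f) (A : Submodule ℤ M) :
    Module.finrank ℤ (A.map f) = Module.finrank ℤ A :=
  (Submodule.equivMapOfInjective f hf A).finrank_eq.symm

theorem img_F_inf_P_eq_map {n m r : ℕ} (g : Sp n) :
    img (F n m) g ⊓ P n r = (((P n r).comap (act g).toLinearMap).comap (inclF n m)).map
      ((act g).toLinearMap ∘ₗ inclF n m) := by
  ext x
  rw [Submodule.mem_inf, mem_img]
  constructor
  · rintro ⟨h1, h2⟩
    rw [← range_inclF] at h1
    obtain ⟨y, hy⟩ := h1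
    have h3 : act g (inclF n m y) = x := by rw [hy]; exact act_act_inv g x
    exact ⟨y, by simpa [h3] using h2, h3⟩
  · rintro ⟨y, hy, rfl⟩
    refine ⟨?_, hy⟩
    rw [LinearMap.comp_apply, LinearEquiv.coe_coe, act_inv_act, ← range_inclF]
    exact ⟨y, rfl⟩

theorem vecMul_lowerBlock {n m r : ℕ} (g : Sp n) (x : {i : Fin n // m ≤ (i : ℕ)} → ℤ)
    (j : {j : Fin n // r ≤ (j : ℕ)}) :
    (x ᵥ* g.1.submatrix (fun i : {i : Fin n // m ≤ (i : ℕ)} => Sum.inr i.1)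
      (fun j : {j : Fin n // r ≤ (j : ℕ)} => Sum.inl j.1)) j
      = act g (inclF n m x) (Sum.inl j.1) := by
  rw [act_apply, vecMul, vecMul, dotProduct, dotProduct]
  let e : {i : Fin n // m ≤ (i : ℕ)} → Fin n ⊕ Fin n := fun i => Sum.inr i.1
  have he : Function.Injective e := Sum.inr_injective.comp Subtype.val_injective
  refine Fintype.sum_of_injective e he _ _ ?_ ?_
  · rintro (i | i) hi
    · simp [inclF]
    · have : ¬ m ≤ (i : ℕ) := fun h => hi ⟨⟨i, h⟩, rfl⟩
      simp [inclF, this]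
  · rintro ⟨i, hi⟩
    simp [inclF, hi, e]

/-- The kernel of the block acting on row vectors consists of the `x` in `F n m` whose image under
`g` has no entries at the coordinates cut out by `P n r`. -/
theorem mem_M_iff {n m r t : ℕ} {g : Sp n} :
    g ∈ M n m r t ↔
      Module.finrank ℤ (img (F n m) g ⊓ P n r : Submodule ℤ (Vec n)) + t = n - m := by
  rw [M, Set.mem_ofPred_eq, ← rank_transpose_int, Matrix.rank, LinearMap.range_eq_map]
  set f := (g.1.submatrix (fun i : {i : Fin n // m ≤ (i : ℕ)} => Sum.inr i.1)
    (fun j : {j : Fin n // r ≤ (j : ℕ)} => Sum.inl j.1))ᵀ.mulVecLin with hf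
  have h1 := finrank_map_add_finrank_inf_ker f ⊤
  rw [top_inf_eq, finrank_top, Module.finrank_pi, card_le_val] at h1
  have hker : LinearMap.ker f = ((P n r).comap (act g).toLinearMap).comap (inclF n m) := by
    ext x
    rw [LinearMap.mem_ker, hf, mulVecLin_apply, mulVec_transpose, funext_iff]
    simp only [vecMul_lowerBlock, Pi.zero_apply]
    exact ⟨fun h j hj => h ⟨j, hj⟩, fun h j => h j.1 j.2⟩
  rw [img_F_inf_P_eq_map, ← hker,
    finrank_map_of_injective (f := (act g).toLinearMap ∘ₗ inclF n m)
      ((act g).injective.comp (inclF_injective n m))]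
  omega

/-- Since the translate of `F n m` is isotropic, vectors of `D` are orthogonal to the last rows of
`g`, so they lie in the kernel of the block acting on columns, which has rank `n - r - t`. This is
what later yields `s ≤ m`. -/
theorem finrank_add_le_of_mem_M {n m r t : ℕ} {g : Sp n} (hg : g ∈ M n m r t)
    {D : Submodule ℤ (Vec n)} (h1 : D ≤ F n r) (h2 : D ≤ img (F n m) g) :
    Module.finrank ℤ D + t ≤ n - r := by
  rw [M, Set.mem_ofPred_eq, Matrix.rank, LinearMap.range_eq_map] at hg
  set f := (g.1.submatrix (fun i : {i : Fin n // m ≤ (i : ℕ)} => Sum.inr i.1)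
    (fun j : {j : Fin n // r ≤ (j : ℕ)} => Sum.inl j.1)).mulVecLin with hf
  have h3 := finrank_map_add_finrank_inf_ker f ⊤
  rw [top_inf_eq, finrank_top, Module.finrank_pi, card_le_val] at h3
  have h4 : D = (D.comap (inclF n r)).map (inclF n r) := by
    rw [Submodule.map_comap_eq, range_inclF, inf_eq_right.2 h1]
  have h5 : D.comap (inclF n r) ≤ LinearMap.ker f := by
    intro y hy
    rw [LinearMap.mem_ker, hf, mulVecLin_apply]
    ext i
    have h6 : om (act g (Pi.single (Sum.inr i.1) 1)) (inclF n r y) = 0 :=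
      (iso_F n m).img g _ (act_mem_img.2 (single_mem_F i.2)) _ (h2 hy)
    have h7 : om (act g (Pi.single (Sum.inr i.1) 1)) (inclF n r y)
        = -∑ j, g.1 (Sum.inr i.1) (Sum.inl j) * inclF n r y (Sum.inr j) := by
      rw [om, ← Finset.sum_neg_distrib]
      refine Finset.sum_congr rfl fun j _ => ?_
      rw [act_single, act_single]
      simp [inclF]
    rw [h7, neg_eq_zero] at h6
    rw [Pi.zero_apply, ← h6, mulVec, dotProduct]
    refine Fintype.sum_of_injective Subtype.val Subtype.val_injective _ _ ?_ ?_
    · intro j hj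
      have : ¬ r ≤ (j : ℕ) := fun h => hj ⟨⟨j, h⟩, rfl⟩
      simp [inclF, this]
    · rintro ⟨j, hj⟩
      simp [inclF, hj]
  have h6 : Module.finrank ℤ D = Module.finrank ℤ (D.comap (inclF n r)) := by
    conv_lhs => rw [h4]
    exact finrank_map_of_injective (inclF_injective n r) _
  have h7 := Submodule.finrank_mono h5
  omega

/-! ### The Jacobi group -/

theorem Jup_subset_J {n k r : ℕ} (hk : k ≤ n) : Jup n k r ⊆ J n r := by
  rintro _ ⟨g, hg, rfl⟩
  rw [mem_J_iff] at hg ⊢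
  intro x hx
  have h1 := hg (res hk x) (res_mem_F hk hx)
  ext (j | j)
  · rw [act_up_inl hk, h1]
    split_ifs <;> rfl
  · rw [act_up_inr hk, h1]
    split_ifs <;> rfl

theorem mul_mem_Jup {n k r : ℕ} {g h : Sp n} (hg : g ∈ Jup n k r) (hh : h ∈ Jup n k r) :
    g * h ∈ Jup n k r := by
  obtain ⟨g, hg, rfl⟩ := hg
  obtain ⟨h, hh, rfl⟩ := hh
  exact ⟨g * h, mul_mem_J hg hh, map_mul _ _ _⟩

theorem inv_mem_Jup {n k r : ℕ} {g : Sp n} (hg : g ∈ Jup n k r) : g⁻¹ ∈ Jup n k r := by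
  obtain ⟨g, hg, rfl⟩ := hg
  exact ⟨g⁻¹, inv_mem_J hg, map_inv _ _⟩

theorem up_mem_J {n r : ℕ} (hr : r ≤ n) (γ : Sp r) : up n γ ∈ J n r := by
  rw [mem_J_iff]
  intro x hx
  ext (j | j)
  · rw [act_up_inl hr, res_eq_zero_of_mem_F hr hx, map_zero, hx.1 j]
    split_ifs <;> rfl
  · rw [act_up_inr hr, res_eq_zero_of_mem_F hr hx, map_zero]
    split_ifs with h
    · exact (hx.2 j h).symm
    · rfl

theorem up_mem_Jup {n k r : ℕ} (hk : k ≤ n) (hr : r ≤ k) (γ : Sp r) : up n γ ∈ Jup n k r :=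
  ⟨up k γ, up_mem_J hr γ, up_up hk hr γ⟩

theorem L_blockGL_mem_Jup {n k r s N : ℕ} (hk : k ≤ n) (hN : s + N ≤ k) (hs : s ≤ r) {d : GLZ N}
    (hd : d ∈ L ⁻¹' J N (r - s)) : L (blockGL s n d) ∈ Jup n k r := by
  refine ⟨L (blockGL s k d), mem_J_iff.2 fun x hx => ?_, up_L_blockGL hk hN d⟩
  have h1 : slice hN x ∈ E N (r - s) := fun j hj => hx.2 _ (by simp only; omega)
  ext (j | j)
  · rw [act_L_blockGL_inl_eq_zero d hx.1, hx.1 j]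
  · rw [act_L_blockGL_inr hN, mem_preimage_L_J_iff.1 hd _ h1]
    split_ifs with hj
    · change x _ = _
      congr 2
      exact Fin.ext (by simp only; omega)
    · rfl

theorem mem_C_of_mem_Qtilde {k r s p : ℕ} (hp : s + (k - r) = p) {q : Sp k}
    (hq : q ∈ Qtilde k r s) : q ∈ C k p := by
  obtain ⟨h1, h2, -, h4⟩ := hq
  refine ⟨fun i j hi => h1 i j (by omega), fun i j hi hj => ?_⟩
  rcases lt_or_ge (j : ℕ) s with h | h
  · exact h2 i j (by omega) h
  · exact h4 i j (by omega) h (by omega)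

theorem img_F_up_of_mem_C {n k p : ℕ} (hk : k ≤ n) (hp : p ≤ k) {q : Sp k} (hq : q ∈ C k p) :
    img (F n p) (up n q) = F n p := by
  rw [← Up_F hk hp, img_Up, img_F_of_mem_C hq]

/-! ### Translates of the standard isotropic subgroups -/

theorem img_F_L_blockGL_eq_G {n s N a p : ℕ} (h : s + N ≤ n) (ha : a ≤ N) (hp : s + a = p)
    (u : GLZ N) : img (F n p) (L (blockGL s n u)) = G h (gimg (E N a) u) := by
  rw [← img_G, G_E h ha, hp]

theorem img_F_L_blockGL_inf_F {n s N r p : ℕ} (h : s + N ≤ n) (hs : s ≤ r) (hr : r ≤ s + N)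
    (hp : p + r = s + s + N) {u : GLZ N} (hu : u ∈ GLstar N (r - s)) :
    img (F n p) (L (blockGL s n u)) ⊓ F n r = F n (s + N) := by
  rw [mem_GLstar_iff (by omega)] at hu
  have h1 : F n r = G h (E N (r - s)) := by rw [G_E h (by omega)]; congr 1; omega
  rw [img_F_L_blockGL_eq_G h (Nat.sub_le N (r - s)) (by omega), h1, ← G_inf, hu, G_bot]

theorem img_F_L_blockGL_le {n s N p : ℕ} (h : s + N ≤ n) (hp : s ≤ p) (u : GLZ N) :
    img (F n p) (L (blockGL s n u)) ≤ F n s := by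
  rw [← img_F_L_blockGL h u]
  exact img_mono (F_le_F hp) _

/-- The ranks give `(n - p) + (n - r) - (n - s - N) = n - s`, so the sum of the two subgroups has
finite index in `F n s`. Hence whatever is known on both summands extends to `F n s` up to a
multiple. -/
theorem exists_smul_mem_sup {n s N r p : ℕ} (h : s + N ≤ n) (hs : s ≤ r) (hr : r ≤ s + N)
    (hp : p + r = s + s + N) {u : GLZ N} (hu : u ∈ GLstar N (r - s)) {x : Vec n}
    (hx : x ∈ F n s) :
    ∃ c : ℤ, c ≠ 0 ∧ ∃ y ∈ img (F n p) (L (blockGL s n u)), ∃ z ∈ F n r, y + z = c • x := by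
  have h1 := finrank_sup_add_finrank_inf (img (F n p) (L (blockGL s n u))) (F n r)
  rw [img_F_L_blockGL_inf_F h hs hr hp hu, finrank_img, finrank_F, finrank_F, finrank_F] at h1
  obtain ⟨c, hc, hmem⟩ := exists_smul_mem_of_finrank_eq
    (sup_le (img_F_L_blockGL_le (p := p) h (by omega) u) (F_le_F (n := n) hs))
    (by rw [finrank_F]; omega) x hx
  exact ⟨c, hc, Submodule.mem_sup.1 hmem⟩

/-! ### Invariants of the representatives -/

/-- A vector `x` of the intersection is orthogonal to `F n r` and to the translate of `F n (m + t)`,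
hence to `F n s` by `exists_smul_mem_sup`. Moved back by `û`, its projection to `ℤ^{2(m+t)}` then
lies in an intersection that the rank condition on `γ` makes trivial. -/
theorem img_F_up_inf_P {n m r s t N : ℕ} (h : s + N ≤ n) (hsm : s ≤ m) (hsr : s ≤ r)
    (hN : m + t + r = s + s + N) {γ : Sp (m + t)} (hγ : γ ∈ M (m + t) m s t) {u : GLZ N}
    (hu : u ∈ GLstar N (r - s)) :
    img (F n m) (up n γ * L (blockGL s n u)) ⊓ P n r
      = img (F n (m + t)) (L (blockGL s n u)) := by
  have hmt : m + t ≤ n := by omega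
  -- The block in `M (m + t) m s t` has only `t` rows, so rank `t` leaves no kernel.
  have hbot : img (F (m + t) m) γ ⊓ P (m + t) s = ⊥ := by
    rw [mem_M_iff] at hγ
    rw [← Submodule.finrank_eq_zero (R := ℤ)]
    omega
  rw [img_mul, ← Up_F hmt (Nat.le_add_right m t), img_Up]
  ext x
  constructor
  · rintro ⟨hx1, hx2⟩
    replace hx1 := mem_img.1 hx1
    rw [mem_img]
    set y := act (L (blockGL s n u))⁻¹ x with hy
    have hys : y ∈ P n s := by
      rw [mem_P_iff_om]
      intro z hz
      have hz' := act_L_blockGL_mem_F h u hz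
      obtain ⟨c, hc, p, hp, q, hq, hpq⟩ := exists_smul_mem_sup h hsr (by omega) hN hu hz'
      have h1 : om x p = 0 := by
        rw [← om_act (L (blockGL s n u))⁻¹]
        exact mem_P_iff_om.1 hx1.1 _ hp
      have h2 : om x q = 0 := mem_P_iff_om.1 hx2 _ hq
      have h3 : c * om x (act (L (blockGL s n u)) z) = 0 := by
        rw [← om_smul_right, ← hpq, om_add_right, h1, h2, add_zero]
      rw [← om_act (L (blockGL s n u)), hy, act_act_inv]
      exact (mul_eq_zero.1 h3).resolve_left hc
    rw [mem_F_iff_res hmt]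
    refine ⟨hx1.1, ?_⟩
    rw [← Submodule.mem_bot ℤ, ← hbot]
    exact ⟨hx1.2, res_mem_P hmt hys⟩
  · intro hx
    exact ⟨img_mono (F_le_Up hmt _) _ hx, F_le_P _ _ _ (img_F_L_blockGL_le h (by omega) u hx)⟩

theorem img_rep_inf_P {n m r s t N : ℕ} (h : s + N ≤ n) (hsm : s ≤ m) (hsr : s ≤ r)
    (hN : m + t + r = s + s + N) {γ : Sp (m + t)} (hγ : γ ∈ M (m + t) m s t) {u : GLZ N}
    (hu : u ∈ GLstar N (r - s)) {j : Sp n} (hj : j ∈ J n r) :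
    img (F n m) (up n γ * L (blockGL s n u) * j) ⊓ P n r
      = img (F n (m + t)) (L (blockGL s n u) * j) := by
  conv_lhs => rw [← img_P_of_img_F (img_F_of_mem_J hj le_rfl)]
  rw [img_mul, ← img_inf, img_F_up_inf_P h hsm hsr hN hγ hu, img_mul]

theorem img_rep_inf_F {n m r s t N : ℕ} (h : s + N ≤ n) (hsm : s ≤ m) (hsr : s ≤ r)
    (hN : m + t + r = s + s + N) {γ : Sp (m + t)} (hγ : γ ∈ M (m + t) m s t) {u : GLZ N}
    (hu : u ∈ GLstar N (r - s)) {j : Sp n} (hj : j ∈ J n r) :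
    img (F n m) (up n γ * L (blockGL s n u) * j) ⊓ F n r = F n (s + N) := by
  have h1 : F n r = P n r ⊓ F n r := (inf_eq_right.2 (F_le_P n r r)).symm
  rw [h1, ← inf_assoc, img_rep_inf_P h hsm hsr hN hγ hu hj]
  conv_lhs => rw [← img_F_of_mem_J hj le_rfl]
  rw [img_mul, ← img_inf, img_F_L_blockGL_inf_F h hsr (by omega) hN hu,
    img_F_of_mem_J hj (by omega)]

/-! ### Uniqueness -/

theorem exists_gact_eq {N : ℕ} (φ : (Fin N → ℤ) ≃ₗ[ℤ] (Fin N → ℤ)) :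
    ∃ d : GLZ N, ∀ x, gact d x = φ x := by
  have h : ∀ ψ : (Fin N → ℤ) ≃ₗ[ℤ] (Fin N → ℤ),
      (LinearMap.toMatrix' ψ.symm.toLinearMap)ᵀ * (LinearMap.toMatrix' ψ.toLinearMap)ᵀ = 1 := by
    intro ψ
    rw [← transpose_mul, ← LinearMap.toMatrix'_comp, LinearEquiv.comp_symm, LinearMap.toMatrix'_id,
      transpose_one]
  refine ⟨⟨_, _, h φ.symm, h φ⟩, fun x => ?_⟩
  rw [gact_apply, vecMul_transpose, LinearMap.toMatrix'_mulVec]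
  rfl

/-- `j` preserves `F n s` and fixes `F n (s + N)`, which is contained in `F n r`; so it induces an
automorphism of the quotient `ℤ^N`. -/
theorem exists_gact_slice_eq {n r s N : ℕ} (h : s + N ≤ n) (hr : r ≤ s + N) {j : Sp n}
    (hj : j ∈ J n r) (hs : img (F n s) j = F n s) :
    ∃ d : GLZ N, ∀ x ∈ F n s, slice h (act j x) = gact d (slice h x) := by
  have hs' : img (F n s) j⁻¹ = F n s := by rw [img_inv_eq, hs]
  have key : ∀ g : Sp n, g ∈ J n r → ∀ x ∈ F n s,
      slice h (act g x) = slice h (act g (spread s n (slice h x))) := by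
    intro g hg x hx
    have h1 : x - spread s n (slice h x) ∈ F n (s + N) := by
      rw [← G_bot h, mem_G, map_sub, slice_spread, sub_self]
      exact ⟨(F n s).sub_mem hx (spread_mem_F _), rfl⟩
    have h2 := mem_J_iff.1 hg _ (F_le_F hr h1)
    rw [← sub_eq_zero, ← map_sub, ← map_sub, h2, map_sub, slice_spread, sub_self]
  have hmem : ∀ g : Sp n, img (F n s) g = F n s → ∀ x ∈ F n s, act g x ∈ F n s := by
    intro g hg x hx
    rw [← hg]
    exact act_mem_img.2 hx
  let φ : (Fin N → ℤ) ≃ₗ[ℤ] (Fin N → ℤ) := LinearEquiv.ofLinearMap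
    (slice h ∘ₗ (act j).toLinearMap ∘ₗ spread s n) (slice h ∘ₗ (act j⁻¹).toLinearMap ∘ₗ spread s n)
    (LinearMap.ext fun x => by
      change slice h (act j (spread s n (slice h (act j⁻¹ (spread s n x))))) = x
      rw [← key j hj _ (hmem _ hs' _ (spread_mem_F x)), act_act_inv, slice_spread])
    (LinearMap.ext fun x => by
      change slice h (act j⁻¹ (spread s n (slice h (act j (spread s n x))))) = x
      rw [← key j⁻¹ (inv_mem_J hj) _ (hmem _ hs _ (spread_mem_F x)), act_inv_act, slice_spread])
  obtain ⟨d, hd⟩ := exists_gact_eq φ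
  refine ⟨d, fun x hx => ?_⟩
  rw [hd, key j hj x hx]
  rfl

theorem img_G_of_slice_eq {n s N : ℕ} (h : s + N ≤ n) {j : Sp n} (hs : img (F n s) j = F n s)
    {d : GLZ N} (hd : ∀ x ∈ F n s, slice h (act j x) = gact d (slice h x))
    (W : Submodule ℤ (Fin N → ℤ)) : img (G h W) j = G h (gimg W d) := by
  ext x
  rw [mem_img, mem_G, mem_G, mem_gimg, ← mem_img, hs]
  refine and_congr_right fun hx => ?_
  rw [← hs] at hx
  have h1 := hd _ hx
  change slice h (act j (act j⁻¹ x)) = _ at h1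
  rw [act_act_inv] at h1
  rw [h1]
  change _ ↔ gact d⁻¹ (gact d (slice h (act j⁻¹ x))) ∈ W
  rw [gact_inv_gact]

theorem mem_preimage_L_J_of_slice_eq {n r s N : ℕ} (h : s + N ≤ n) (hs : s ≤ r) {j : Sp n}
    (hj : j ∈ J n r) {d : GLZ N} (hr : r ≤ s + N)
    (hd : ∀ x ∈ F n s, slice h (act j x) = gact d (slice h x)) : d ∈ L ⁻¹' J N (r - s) := by
  rw [mem_preimage_L_J_iff]
  intro y hy
  have h1 : spread s n y ∈ F n r := by
    have h2 : F n r = G h (E N (r - s)) := by rw [G_E h (by omega)]; congr 1; omega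
    rw [h2, spread_mem_G]
    exact hy
  have h3 := hd _ (spread_mem_F y)
  rwa [mem_J_iff.1 hj _ h1, slice_spread, eq_comm] at h3

/-- `F n s` is the saturation of `F n r` plus the translate by `û`. The element `j` fixes the first
summand pointwise and sends the second into `F n s`. -/
theorem img_F_eq_of_img_eq {n r s N p : ℕ} (h : s + N ≤ n) (hs : s ≤ r) (hr : r ≤ s + N)
    (hp : p + r = s + s + N) {u v : GLZ N} (hu : u ∈ GLstar N (r - s)) {j : Sp n} (hj : j ∈ J n r)
    (he : img (img (F n p) (L (blockGL s n u))) j = img (F n p) (L (blockGL s n v))) :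
    img (F n s) j = F n s := by
  refine img_eq_self_of_forall fun x hx => ?_
  obtain ⟨c, hc, y, hy, z, hz, hyz⟩ := exists_smul_mem_sup h hs hr hp hu hx
  refine sat_F n s c hc _ ?_
  rw [← map_smul, ← hyz, map_add, mem_J_iff.1 hj z hz]
  refine (F n s).add_mem ?_ (F_le_F hs hz)
  refine img_F_L_blockGL_le (p := p) h (by omega) v ?_
  rw [← he]
  exact act_mem_img.2 hy

/-- The automorphism `d` of `F n s / F n (s + N)` induced by `j` fixes the image of `F n r`, hence
lies in the Jacobi part; `u * d` and `v` then carry `E N a` to the same subgroup. -/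
theorem exists_double_coset_eq {n r s N a : ℕ} (h : s + N ≤ n) (hs : s ≤ r) (hr : r ≤ s + N)
    (ha : a + (r - s) = N) {u v : GLZ N} (hu : u ∈ GLstar N (r - s)) {j : Sp n} (hj : j ∈ J n r)
    (he : img (img (F n (s + a)) (L (blockGL s n u))) j
      = img (F n (s + a)) (L (blockGL s n v))) :
    ∃ c ∈ L ⁻¹' C N a, ∃ d ∈ L ⁻¹' J N (r - s), v = c * u * d := by
  have hjs := img_F_eq_of_img_eq h hs hr (by omega) hu hj he
  obtain ⟨d, hd⟩ := exists_gact_slice_eq h hr hj hjs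
  have hdJ := mem_preimage_L_J_of_slice_eq h hs hj hr hd
  rw [img_F_L_blockGL_eq_G h (by omega) rfl, img_F_L_blockGL_eq_G h (by omega) rfl,
    img_G_of_slice_eq h hjs hd, ← gimg_mul] at he
  obtain ⟨c, hc, hv⟩ := exists_mem_parabolicGL_mul_iff.2 (G_injective he).symm
  rw [preimage_L_C]
  exact ⟨c, hc, d, hdJ, by rw [hv, mul_assoc]⟩

theorem mem_Qtilde_of_img {k r s p : ℕ} (hp : s + (k - r) = p) {q : Sp k}
    (h1 : img (F k s) q = F k s) (h2 : img (F k p) q = F k p)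
    (h3 : ∀ x ∈ F k s, act q x - x ∈ F k p) : q ∈ Qtilde k r s := by
  have hF : ∀ i : Fin k, s ≤ (i : ℕ) → act q (Pi.single (Sum.inr i) 1) ∈ F k s := by
    intro i hi
    rw [← h1]
    exact act_mem_img.2 (single_mem_F hi)
  refine ⟨fun i j hij => ?_, fun i j hi hj => ?_, fun i j hi _ hj hj' => ?_,
    fun i j hi _ hj => ?_⟩
  · rw [← act_single]
    rcases lt_or_ge (i : ℕ) s with hi | hi
    · have h4 : act q (Pi.single (Sum.inr i) 1) ∈ P k s := by
        rw [← img_P_of_img_F h1]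
        exact act_mem_img.2 (F_le_P k 0 s (single_mem_F (Nat.zero_le _)))
      exact h4 j (by omega)
    · exact (hF i hi).1 j
  · rw [← act_single]
    exact (hF i hi).2 j hj
  · have h4 := (h3 _ (single_mem_F hi)).2 j (by omega)
    rw [Pi.sub_apply, act_single, sub_eq_zero] at h4
    rw [h4, Pi.single_apply]
    simp [eq_comm]
  · rw [← act_single]
    have h4 : act q (Pi.single (Sum.inr i) 1) ∈ F k p := by
      rw [← h2]
      exact act_mem_img.2 (single_mem_F (by omega))
    exact h4.2 j (by omega)

/-- The conjugate of `j` by `û` stabilizes `F n s` and `F n p`. It acts trivially on `F n s / F n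
p`, because up to a multiple this quotient comes from `F n r`, which `j` fixes; that is the identity
block in `Qtilde`. -/
theorem mem_gammaTwoGroup_of_img_eq {n k r s N p : ℕ} (hk : k ≤ n) (h : s + N = k) (hs : s ≤ r)
    (hr : r ≤ k) (hp : s + (k - r) = p) {u : GLZ N} (hu : u ∈ GLstar N (r - s)) {j : Sp n}
    (hj : j ∈ Jup n k r)
    (he : img (img (F n p) (L (blockGL s n u))) j = img (F n p) (L (blockGL s n u))) :
    j ∈ gammaTwoGroup n k r s (blockGL s n u) := by
  have hN : s + N ≤ n := by omega
  have hjJ := Jup_subset_J hk hj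
  refine ⟨hj, ?_⟩
  obtain ⟨g, hg, rfl⟩ := hj
  set l := L (blockGL s k u) with hl
  have hul : up n l = L (blockGL s n u) := up_L_blockGL hk h.le u
  have hq : up n (l * g * l⁻¹) = L (blockGL s n u) * up n g * (L (blockGL s n u))⁻¹ := by
    rw [map_mul, map_mul, map_inv, hul]
  have hgs := img_F_eq_of_img_eq (p := p) hN hs (by omega) (by omega) hu hjJ he
  refine ⟨l * g * l⁻¹, mem_Qtilde_of_img hp ?_ ?_ ?_, ?_⟩
  · apply Up_injective (h := hk)
    rw [← img_Up, Up_F hk (by omega), hq, img_mul, img_mul, img_F_L_blockGL hN, hgs, img_inv_eq,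
      img_F_L_blockGL hN]
  · apply Up_injective (h := hk)
    rw [← img_Up, Up_F hk (by omega), hq, img_mul, img_mul, he, img_inv_eq]
  · have key : ∀ x ∈ F n s, act (up n (l * g * l⁻¹)) x - x ∈ F n p := by
      intro x hx
      obtain ⟨c, hc, y, hy, z, hz, hyz⟩ := exists_smul_mem_sup (p := p) hN hs (by omega) (by omega) hu
        (act_L_blockGL_mem_F hN u hx)
      refine sat_F n p c hc _ ?_
      have h1 : act (up n g) y - y ∈ img (F n p) (L (blockGL s n u)) := by
        refine Submodule.sub_mem _ ?_ hy
        rw [← he]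
        exact act_mem_img.2 hy
      -- Moved forward by `û`, the difference is `(y + z) j - (y + z) = y j - y`, as `j` fixes `z`.
      rw [← act_mem_img (g := L (blockGL s n u))]
      have h2 : act (L (blockGL s n u)) (c • (act (up n (l * g * l⁻¹)) x - x))
          = act (up n g) y - y := by
        rw [map_smul, map_sub, hq, act_mul, act_mul, act_act_inv, smul_sub, ← map_smul, ← hyz,
          map_add, mem_J_iff.1 hjJ z hz]
        abel
      rwa [h2]
    intro x hx
    have hx' : ext n x ∈ F n s := by
      rw [← Up_F hk (by omega), ext_mem_Up]
      exact hx
    have h1 := res_mem_F hk (key _ hx')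
    rwa [map_sub, res_act_up, res_ext] at h1
  · rw [hq, map_inv]
    group

theorem img_F_L_mul_of_mem_gammaTwoGroup {n k r s N p : ℕ} (hk : k ≤ n) (hr : r ≤ k) (hs : s ≤ r)
    (hp : s + (k - r) = p) {u : GLZ N} {j : Sp n}
    (hj : j ∈ gammaTwoGroup n k r s (blockGL s n u)) :
    img (F n p) (L (blockGL s n u) * j) = img (F n p) (L (blockGL s n u)) := by
  obtain ⟨-, q, hq, rfl⟩ := hj
  have h1 : L (blockGL s n u) * (L (blockGL s n u)⁻¹ * up n q * L (blockGL s n u))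
      = up n q * L (blockGL s n u) := by
    rw [map_inv]
    group
  rw [h1, img_mul, img_F_up_of_mem_C hk (by omega) (mem_C_of_mem_Qtilde hp hq)]

theorem img_F_L_tilde {n r a : ℕ} (hr : r + (n - r) ≤ n) (ha : a ≤ n - r) (u : GLZ (n - r)) :
    img (F n (r + a)) (L (tildeGL n r u)) = G hr (gimg (E (n - r) a) u) :=
  img_F_L_blockGL_eq_G hr ha rfl u

/-! ### Existence -/

theorem Iso.saturation {n : ℕ} {W : Submodule ℤ (Vec n)} (h : Iso W) : Iso (saturation W) := by
  rintro x ⟨c, hc, hx⟩ y ⟨d, hd, hy⟩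
  have h1 := h _ hx _ hy
  rw [om_smul_left, om_smul_right] at h1
  exact (mul_eq_zero.1 ((mul_eq_zero.1 h1).resolve_left hc)).resolve_left hd

/-- Here `s` originates: the projection of `W ∩ P n r` to `ℤ^{2r}` is isotropic of rank `r - s` and
has kernel `W ∩ F n r`. It need not be saturated, hence the saturation. -/
theorem exists_saturation_map_res_eq {n m r t : ℕ} (hr : r ≤ n) {g : Sp n} (hg : g ∈ M n m r t) :
    ∃ s ≤ r, ∃ γ : Sp r,
      saturation ((img (F n m) g ⊓ P n r).map (res hr)) = img (F r s) γ ∧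
      Module.finrank ℤ (img (F n m) g ⊓ F n r : Submodule ℤ (Vec n)) + (r - s) + t = n - m := by
  have hiso : Iso ((img (F n m) g ⊓ P n r).map (res hr)) := by
    rintro _ ⟨x, hx, rfl⟩ _ ⟨y, hy, rfl⟩
    rw [om_res hr hx.2 hy.2]
    exact (iso_F n m).img g _ hx.1 _ hy.1
  obtain ⟨s, hs, γ, hγ⟩ := exists_img_F_eq (sat_saturation _) hiso.saturation
  refine ⟨s, hs, γ, hγ, ?_⟩
  have h1 := finrank_map_add_finrank_inf_ker (res hr) (img (F n m) g ⊓ P n r)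
  have h2 : img (F n m) g ⊓ P n r ⊓ LinearMap.ker (res hr) = img (F n m) g ⊓ F n r := by
    rw [inf_assoc]
    congr 1
    ext x
    rw [Submodule.mem_inf, LinearMap.mem_ker, mem_F_iff_res hr]
  rw [h2, ← finrank_saturation, hγ, finrank_img, finrank_F] at h1
  rw [mem_M_iff] at hg
  omega

/-- The intersection is saturated in `F n r`, so it is a translate of some `F n (r + a)`. Rank
counting gives `a = m + t - s`; the bounds `t ≤ a` and `a ≤ n - r` are the two remaining
inequalities for `s`. -/
theorem exists_inf_F_eq {n m r t : ℕ} (hm : m ≤ n) (hr : r ≤ n) {g : Sp n} (hg : g ∈ M n m r t) :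
    ∃ s, s ≤ m ∧ s ≤ r ∧ m + t + r ≤ n + s ∧ ∃ u : GLZ (n - r),
      img (F n m) g ⊓ F n r = img (F n (r + (m + t - s))) (L (tildeGL n r u)) := by
  have hrn : r + (n - r) ≤ n := by omega
  obtain ⟨s, hs, -, -, hrank⟩ := exists_saturation_map_res_eq hr hg
  have h1 := eq_G_comap_spread (W := img (F n m) g ⊓ F n r) hrn
    (by rw [F_eq_bot (by omega)]; exact bot_le) inf_le_right
  obtain ⟨a, ha, u, hu⟩ := exists_gimg_E_eq
    (((((sat_F n m).img g).inf (sat_F n r))).comap (spread r n (N := n - r)))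
  rw [hu, ← img_F_L_tilde hrn ha] at h1
  have h2 := finrank_add_le_of_mem_M hg (D := img (F n m) g ⊓ F n r) inf_le_right inf_le_left
  rw [mem_M_iff] at hg
  rw [h1, finrank_img, finrank_F] at h2 hrank
  refine ⟨s, by omega, hs, by omega, u, ?_⟩
  rw [h1]
  congr 2
  omega

/-- With `γ` straightening the projection to `ℤ^{2r}`, the group `W ∩ P n r` moves between `F n (s +
N)` and `F n s`, hence comes from a saturated subgroup of `ℤ^N`. That subgroup meets `E N (r - s)`
trivially because `W ∩ F n r` is no larger than `F n (s + N)`. -/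
theorem exists_inf_P_eq {n m r s t N : ℕ} (h : s + N ≤ n) (hsm : s ≤ m) (hsr : s ≤ r)
    (hmn : m ≤ n) (hN : m + t + r = s + s + N) {g : Sp n} (hg : g ∈ M n m r t)
    (hF : img (F n m) g ⊓ F n r = F n (s + N)) :
    ∃ u ∈ GLstar N (r - s), ∃ j ∈ Jup n (s + N) r,
      img (F n m) g ⊓ P n r = img (F n (m + t)) (L (blockGL s n u) * j) := by
  have hr : r ≤ n := by omega
  obtain ⟨s', hs', γ, hγ, hrank⟩ := exists_saturation_map_res_eq hr hg
  rw [hF, finrank_F] at hrank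
  have hss : s' = s := by omega
  subst hss
  set W := img (F n m) g ⊓ P n r with hW
  have hj := up_mem_J hr γ
  have hF' : img (F n (s' + N)) (up n γ)⁻¹ = F n (s' + N) :=
    img_F_of_mem_J (inv_mem_J hj) (by omega)
  have h1 : F n (s' + N) ≤ img W (up n γ)⁻¹ := by
    rw [← hF']
    refine img_mono ?_ _
    rw [← hF]
    exact inf_le_inf_left _ (F_le_P n r r)
  have h2 : img W (up n γ)⁻¹ ≤ F n s' := by
    intro x hx
    have hx' : act (up n γ) x ∈ W := by simpa only [mem_img, inv_inv] using hx
    rw [← Up_F hr hs', mem_Up]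
    refine ⟨(act_up_mem_P hr γ).1 hx'.2, ?_⟩
    rw [← act_mem_img (g := γ), ← hγ, ← res_act_up hr]
    exact le_saturation _ ⟨_, hx', rfl⟩
  have h3 := eq_G_comap_spread h h1 h2
  obtain ⟨b, hb, u, hu⟩ := exists_gimg_E_eq
    (((((sat_F n m).img g).inf (sat_P n r)).img (up n γ)⁻¹).comap (spread s' n (N := N)))
  rw [← hW] at hu
  rw [hu] at h3
  have h4 : img W (up n γ)⁻¹ = img (F n (s' + b)) (L (blockGL s' n u)) := by
    rw [h3, img_F_L_blockGL_eq_G h hb rfl]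
  have h5 : Module.finrank ℤ W = n - (s' + b) := by
    rw [← finrank_img W (up n γ)⁻¹, h4, finrank_img, finrank_F]
  have h6 := mem_M_iff.1 hg
  rw [← hW] at h6
  have h7 : s' + b = m + t := by omega
  refine ⟨u, ?_, up n γ, up_mem_Jup h (by omega) γ, ?_⟩
  · rw [mem_GLstar_iff (by omega)]
    apply G_injective (h := h)
    have h8 : N - (r - s') = b := by omega
    have h9 : s' + (r - s') = r := by omega
    rw [G_inf, G_E h (by omega), h8, h9, ← h3, G_bot, ← img_F_of_mem_J (inv_mem_J hj) le_rfl,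
      ← img_inf]
    have h10 : W ⊓ F n r = F n (s' + N) := by
      rw [hW, inf_assoc, inf_eq_right.2 (F_le_P n r r), hF]
    rw [h10, hF']
  · rw [img_mul, ← h7, ← h4, ← img_mul, inv_mul_cancel, img_one]

/-- Moved back by `l`, the subgroup contains `F n (m + t)` and is therefore pulled back from
`ℤ^{2(m+t)}`. A vector violating the rank condition on `γ` would give an element of `W ∩ P n r`
outside the translate of `F n (m + t)`. -/
theorem exists_rep_of_inf_P_eq {n m r s t N : ℕ} (h : s + N ≤ n) (hsr : s ≤ r) (hsm : s ≤ m)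
    (hmt : m + t ≤ n) {g : Sp n} {u : GLZ N} {j : Sp n} (hj : j ∈ J n r)
    (hP : img (F n m) g ⊓ P n r = img (F n (m + t)) (L (blockGL s n u) * j)) :
    ∃ γ ∈ M (m + t) m s t, img (F n m) g = img (F n m) (up n γ * L (blockGL s n u) * j) := by
  set l := L (blockGL s n u) * j with hl
  have h1 : F n (m + t) ≤ img (img (F n m) g) l⁻¹ := by
    have h2 : F n (m + t) = img (img (F n m) g ⊓ P n r) l⁻¹ := by
      rw [hP, ← img_mul, mul_inv_cancel, img_one]
    rw [h2]
    exact img_mono inf_le_left _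
  have hiso := ((iso_F n m).img g).img l⁻¹
  have hsat := ((sat_F n m).img g).img l⁻¹
  have h2 := eq_Up_comap_ext hmt hiso h1
  obtain ⟨m', hm', γ, hγ⟩ := exists_img_F_eq (hsat.comap (ext n)) (hiso.comap_ext hmt)
  have h3 : img (img (F n m) g) l⁻¹ = img (F n m') (up n γ) := by
    rw [h2, hγ, ← img_Up, Up_F hmt hm']
  have hmm : m' = m := finrank_img_F_inj (by omega) (by omega) h3
    (by rw [finrank_img, finrank_img, finrank_F])
  subst hmm
  refine ⟨γ, ?_, ?_⟩
  · have h4 : img (F (m' + t) m') γ ⊓ P (m' + t) s = ⊥ := by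
      rw [eq_bot_iff]
      rintro x ⟨hx1, hx2⟩
      have hx1' : ext n x ∈ img (img (F n m') g) l⁻¹ := by
        rw [← hγ] at hx1
        exact hx1
      rw [mem_img, inv_inv] at hx1'
      have hx2' : ext n x ∈ P n s := by
        intro i hi
        rw [ext_inl]
        split_ifs with h5
        · exact hx2 ⟨i, h5⟩ hi
        · rfl
      have hx3 : act l (ext n x) ∈ P n r := by
        rw [mem_P_iff_om]
        intro y hy
        rw [← om_act l⁻¹, act_inv_act]
        refine mem_P_iff_om.1 hx2' _ ?_
        -- `j` fixes `y`, and `û` preserves `F n s`, which contains `F n r`.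
        have h5 : act l⁻¹ y = act (L (blockGL s n u))⁻¹ y := by
          rw [hl, _root_.mul_inv_rev, act_mul, mem_J_iff.1 (inv_mem_J hj) y hy]
        rw [h5, ← mem_img, img_F_L_blockGL h]
        exact F_le_F hsr hy
      have hx4 : act l (ext n x) ∈ img (F n (m' + t)) l := by
        rw [← hP]
        exact ⟨hx1', hx3⟩
      have hx5 := res_eq_zero_of_mem_F hmt (act_mem_img.1 hx4)
      rwa [res_ext] at hx5
    rw [mem_M_iff, h4, finrank_bot]
    omega
  · rw [mul_assoc, ← hl, img_mul, ← h3, ← img_mul, inv_mul_cancel, img_one]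

/-! ### The coset representatives -/

theorem img_F_L_tilde_self {n r : ℕ} (hr : r ≤ n) (u : GLZ (n - r)) :
    img (F n r) (L (tildeGL n r u)) = F n r :=
  img_F_L_blockGL (by omega) u

theorem img_P_L_tilde_self {n r : ℕ} (hr : r ≤ n) (u : GLZ (n - r)) :
    img (P n r) (L (tildeGL n r u)) = P n r :=
  img_P_of_img_F (img_F_L_tilde_self hr u)

theorem mul_L_tilde_mem_M_iff {n m r t : ℕ} (hr : r ≤ n) {g : Sp n} (u : GLZ (n - r)) :
    g * L (tildeGL n r u) ∈ M n m r t ↔ g ∈ M n m r t := by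
  rw [mem_M_iff, mem_M_iff, img_mul]
  conv_lhs => rw [← img_P_L_tilde_self hr u, ← img_inf, finrank_img]

theorem img_F_up_eq_of_img_F_eq {n k m : ℕ} (hk : k ≤ n) (hm : m ≤ k) {γ γ' : Sp k}
    (h : img (F k m) γ = img (F k m) γ') : img (F n m) (up n γ) = img (F n m) (up n γ') := by
  rw [← Up_F hk hm, img_Up, img_Up, h]

theorem img_F_eq_of_img_F_up_eq {n k m : ℕ} (hk : k ≤ n) (hm : m ≤ k) {γ γ' : Sp k}
    (h : img (F n m) (up n γ) = img (F n m) (up n γ')) : img (F k m) γ = img (F k m) γ' := by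
  rw [← Up_F hk hm, img_Up, img_Up] at h
  exact Up_injective h

theorem IsCosetReps.eq_of_mul {G : Type*} [Group G] {H X S : Set G} (hS : IsCosetReps H X S)
    (h1 : (1 : G) ∈ H) {x y : G} (hx : x ∈ S) (hy : y ∈ S) (h : ∃ c ∈ H, x = c * y) : x = y :=
  (hS.2 x (hS.1 hx)).unique ⟨hx, 1, h1, (one_mul x).symm⟩ ⟨hy, h⟩

theorem one_mem_Jup (n k r : ℕ) : (1 : Sp n) ∈ Jup n k r := ⟨1, one_mem_J k r, map_one _⟩

theorem one_mem_C (n m : ℕ) : (1 : Sp n) ∈ C n m := mem_C_iff.2 fun x hx => by rwa [act_one]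

theorem one_mem_parabolicGL (N a : ℕ) : (1 : GLZ N) ∈ parabolicGL N a :=
  mem_parabolicGL_iff.2 fun x hx => by rwa [gact_one]

/-- For one value of `s`, the sets `R₁`, `R₂`, `Γ₁`, `Γ₂ u` are sets of representatives of the
(double) cosets that parametrize `C_{n,m} \ M_{n,m,r}^t`. -/
structure Reps (n m r t s : ℕ) (R₁ : Set (GLZ (m + r + t - 2 * s))) (R₂ : Set (GLZ (n - r)))
    (Γ₁ : Set (Sp (m + t))) (Γ₂ : GLZ (m + r + t - 2 * s) → Set (Sp n)) : Prop where
  hR₁ : IsDoubleCosetReps (L ⁻¹' C (m + r + t - 2 * s) (m + t - s))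
    (L ⁻¹' J (m + r + t - 2 * s) (r - s)) (GLstar (m + r + t - 2 * s) (r - s)) R₁
  hR₂ : IsCosetReps (parabolicGL (n - r) (m + t - s)) Set.univ R₂
  hΓ₁ : IsCosetReps (C (m + t) m) (M (m + t) m s t) Γ₁
  hΓ₂ : ∀ u ∈ R₁, IsCosetReps (gammaTwoGroup n (m + t + r - s) r s (hatGL n s u))
    (Jup n (m + t + r - s) r) (Γ₂ u)

section

variable {n m r t s : ℕ} {R₁ : Set (GLZ (m + r + t - 2 * s))} {R₂ : Set (GLZ (n - r))}
  {Γ₁ : Set (Sp (m + t))} {Γ₂ : GLZ (m + r + t - 2 * s) → Set (Sp n)}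

theorem Reps.img_inf_F (hR : Reps n m r t s R₁ R₂ Γ₁ Γ₂) (hsm : s ≤ m) (hsr : s ≤ r)
    (hn : m + t + r ≤ n + s) {γ₁ : Sp (m + t)} {u : GLZ (m + r + t - 2 * s)} {γ₂ : Sp n}
    (u' : GLZ (n - r)) (h1 : γ₁ ∈ Γ₁) (hu : u ∈ R₁) (h2 : γ₂ ∈ Γ₂ u) :
    img (F n m) (up n γ₁ * L (hatGL n s u) * γ₂ * L (tildeGL n r u')) ⊓ F n r
      = img (F n (r + (m + t - s))) (L (tildeGL n r u')) := by
  have hj := Jup_subset_J (by omega) ((hR.hΓ₂ u hu).1 h2)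
  conv_lhs => rw [← img_F_L_tilde_self (by omega) u']
  rw [img_mul _ (up n γ₁ * L (hatGL n s u) * γ₂), ← img_inf, hatGL,
    img_rep_inf_F (by omega) hsm hsr (by omega) (hR.hΓ₁.1 h1) (hR.hR₁.1 hu) hj]
  congr 2
  omega

theorem Reps.mem_M (hR : Reps n m r t s R₁ R₂ Γ₁ Γ₂) (hsm : s ≤ m) (hsr : s ≤ r)
    (hn : m + t + r ≤ n + s) {γ₁ : Sp (m + t)} {u : GLZ (m + r + t - 2 * s)} {γ₂ : Sp n}
    (u' : GLZ (n - r)) (h1 : γ₁ ∈ Γ₁) (hu : u ∈ R₁) (h2 : γ₂ ∈ Γ₂ u) :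
    up n γ₁ * L (hatGL n s u) * γ₂ * L (tildeGL n r u') ∈ M n m r t := by
  have hj := Jup_subset_J (by omega) ((hR.hΓ₂ u hu).1 h2)
  rw [mul_L_tilde_mem_M_iff (by omega), mem_M_iff, hatGL,
    img_rep_inf_P (by omega) hsm hsr (by omega) (hR.hΓ₁.1 h1) (hR.hR₁.1 hu) hj, finrank_img,
    finrank_F]
  omega

/-- The parameters are recovered in the order `u'`, `u`, `γ₂`, `γ₁`: the intersection with `F n r`
gives `u'`, the one with `P n r` gives `u` and then `γ₂`, and the whole subgroup gives `γ₁`. -/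
theorem Reps.unique (hR : Reps n m r t s R₁ R₂ Γ₁ Γ₂) (hsm : s ≤ m) (hsr : s ≤ r)
    (hn : m + t + r ≤ n + s) {γ₁ δ₁ : Sp (m + t)} {u v : GLZ (m + r + t - 2 * s)} {γ₂ δ₂ : Sp n}
    {u' v' : GLZ (n - r)} (hγ₁ : γ₁ ∈ Γ₁) (hu : u ∈ R₁) (hγ₂ : γ₂ ∈ Γ₂ u) (hu' : u' ∈ R₂)
    (hδ₁ : δ₁ ∈ Γ₁) (hv : v ∈ R₁) (hδ₂ : δ₂ ∈ Γ₂ v) (hv' : v' ∈ R₂)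
    (he : img (F n m) (up n γ₁ * L (hatGL n s u) * γ₂ * L (tildeGL n r u'))
      = img (F n m) (up n δ₁ * L (hatGL n s v) * δ₂ * L (tildeGL n r v'))) :
    γ₁ = δ₁ ∧ u = v ∧ γ₂ = δ₂ ∧ u' = v' := by
  have hrn : r + (n - r) ≤ n := by omega
  have hN : s + (m + r + t - 2 * s) ≤ n := by omega
  have hN' : m + t + r = s + s + (m + r + t - 2 * s) := by omega
  have hk : m + t + r - s ≤ n := by omega
  have huv' : u' = v' := by
    have h1 := hR.img_inf_F hsm hsr hn u' hγ₁ hu hγ₂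
    rw [he, hR.img_inf_F hsm hsr hn v' hδ₁ hv hδ₂, img_F_L_tilde hrn (by omega),
      img_F_L_tilde hrn (by omega)] at h1
    exact hR.hR₂.eq_of_mul (one_mem_parabolicGL _ _) hu' hv'
      (exists_mem_parabolicGL_mul_iff.2 (G_injective h1).symm)
  subst huv'
  rw [img_mul _ (up n γ₁ * L (hatGL n s u) * γ₂), img_mul _ (up n δ₁ * L (hatGL n s v) * δ₂)] at he
  replace he := img_injective he
  have hγJ := (hR.hΓ₂ u hu).1 hγ₂
  have hδJ := (hR.hΓ₂ v hv).1 hδ₂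
  have huG := hR.hR₁.1 hu
  have h1 := img_rep_inf_P hN hsm hsr hN' (hR.hΓ₁.1 hγ₁) huG (Jup_subset_J hk hγJ)
  rw [hatGL, hatGL] at he
  rw [he, img_rep_inf_P hN hsm hsr hN' (hR.hΓ₁.1 hδ₁) (hR.hR₁.1 hv) (Jup_subset_J hk hδJ)] at h1
  have hh : γ₂ * δ₂⁻¹ ∈ Jup n (m + t + r - s) r := mul_mem_Jup hγJ (inv_mem_Jup hδJ)
  have h2 : img (img (F n (m + t)) (L (blockGL s n u))) (γ₂ * δ₂⁻¹)
      = img (F n (m + t)) (L (blockGL s n v)) := by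
    rw [img_mul, ← img_mul _ (L (blockGL s n u)), ← h1, img_mul, ← img_mul _ δ₂, mul_inv_cancel,
      img_one]
  have huv : u = v := by
    have hmt : m + t = s + (m + t - s) := by omega
    rw [hmt] at h2
    obtain ⟨c, hc, d, hd, hcd⟩ :=
      exists_double_coset_eq hN hsr (by omega) (by omega) huG (Jup_subset_J hk hh) h2
    refine (hR.hR₁.2 v (hR.hR₁.1 hv)).unique ⟨hu, c, hc, d, hd, hcd⟩
      ⟨hv, 1, ?_, 1, ?_, by group⟩
    · rw [preimage_L_C]
      exact one_mem_parabolicGL _ _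
    · rw [Set.mem_preimage, map_one]
      exact one_mem_J _ _
  subst huv
  have hG : ∀ j ∈ Jup n (m + t + r - s) r,
      img (img (F n (m + t)) (L (blockGL s n u))) j = img (F n (m + t)) (L (blockGL s n u)) →
      j ∈ gammaTwoGroup n (m + t + r - s) r s (hatGL n s u) := fun j hj hj' =>
    mem_gammaTwoGroup_of_img_eq hk (by omega) hsr (by omega) (by omega) huG hj hj'
  have hγδ : γ₂ = δ₂ := (hR.hΓ₂ u hu).eq_of_mul (hG 1 (one_mem_Jup _ _ _) (img_one _)) hγ₂ hδ₂
    ⟨_, hG _ hh h2, by group⟩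
  subst hγδ
  rw [mul_assoc, mul_assoc, img_mul, img_mul _ (up n δ₁)] at he
  have h3 := img_F_eq_of_img_F_up_eq (by omega) (by omega) (img_injective he)
  exact ⟨hR.hΓ₁.eq_of_mul (one_mem_C _ _) hγ₁ hδ₁ (exists_mem_C_mul_iff.2 h3), rfl, rfl, rfl⟩

theorem Reps.exists_rep (hR : Reps n m r t s R₁ R₂ Γ₁ Γ₂) (hmn : m ≤ n) (hsm : s ≤ m)
    (hsr : s ≤ r) (hn : m + t + r ≤ n + s) (hmt : m + t ≤ n) {g : Sp n} (hg : g ∈ M n m r t)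
    {w : GLZ (n - r)}
    (hw : img (F n m) g ⊓ F n r = img (F n (r + (m + t - s))) (L (tildeGL n r w))) :
    ∃ γ₁ ∈ Γ₁, ∃ u ∈ R₁, ∃ γ₂ ∈ Γ₂ u, ∃ u' ∈ R₂, img (F n m) g
      = img (F n m) (up n γ₁ * L (hatGL n s u) * γ₂ * L (tildeGL n r u')) := by
  have hrn : r + (n - r) ≤ n := by omega
  have hr : r ≤ n := by omega
  have hN : s + (m + r + t - 2 * s) ≤ n := by omega
  have hN' : m + t + r = s + s + (m + r + t - 2 * s) := by omega
  have hk : m + t + r - s ≤ n := by omega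
  obtain ⟨u', ⟨hu', hwu⟩, -⟩ := hR.hR₂.2 w (Set.mem_univ _)
  rw [img_F_L_tilde hrn (by omega), exists_mem_parabolicGL_mul_iff.1 hwu,
    ← img_F_L_tilde hrn (by omega)] at hw
  obtain ⟨g, rfl⟩ : ∃ g', g = g' * L (tildeGL n r u') := ⟨g * (L (tildeGL n r u'))⁻¹, by group⟩
  rw [mul_L_tilde_mem_M_iff hr] at hg
  conv_lhs at hw => rw [← img_F_L_tilde_self hr u']
  rw [img_mul, ← img_inf] at hw
  replace hw := img_injective hw
  have hrs : r + (m + t - s) = s + (m + r + t - 2 * s) := by omega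
  rw [hrs] at hw
  obtain ⟨v, hv, j, hj, hP⟩ := exists_inf_P_eq hN hsm hsr hmn hN' hg hw
  have hkN : s + (m + r + t - 2 * s) = m + t + r - s := by omega
  rw [hkN] at hj
  obtain ⟨u, ⟨hu, c, hc, d, hd, rfl⟩, -⟩ := hR.hR₁.2 v hv
  -- Of the factors in `c * u * d`, the right one is absorbed into the Jacobi element and the left
  -- one stabilizes `F n (m + t)`.
  have hj1 : L (blockGL s n d) * j ∈ Jup n (m + t + r - s) r :=
    mul_mem_Jup (L_blockGL_mem_Jup hk (by omega) hsr hd) hj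
  obtain ⟨γ₂, ⟨hγ₂, κ, hκ, hκγ⟩, -⟩ := (hR.hΓ₂ u hu).2 _ hj1
  have hP' : img (F n m) g ⊓ P n r = img (F n (m + t)) (L (blockGL s n u) * γ₂) := by
    rw [preimage_L_C] at hc
    have h1 : img (F n (m + t)) (L (blockGL s n (c * u)))
        = img (F n (m + t)) (L (blockGL s n u)) := by
      rw [img_F_L_blockGL_eq_G (a := m + t - s) hN (by omega) (by omega),
        img_F_L_blockGL_eq_G (a := m + t - s) hN (by omega) (by omega),
        exists_mem_parabolicGL_mul_iff.1 ⟨c, hc, rfl⟩]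
    rw [hP, map_mul (blockGL s n), map_mul L, mul_assoc, hκγ, img_mul, h1, ← img_mul, ← mul_assoc,
      img_mul, img_F_L_mul_of_mem_gammaTwoGroup hk (by omega) hsr (by omega) hκ, ← img_mul]
  have hγJ := Jup_subset_J hk ((hR.hΓ₂ u hu).1 hγ₂)
  obtain ⟨γ, hγ, hgγ⟩ := exists_rep_of_inf_P_eq hN hsr hsm hmt hγJ hP'
  obtain ⟨γ₁, ⟨hγ₁, hγγ₁⟩, -⟩ := hR.hΓ₁.2 γ hγ
  refine ⟨γ₁, hγ₁, u, hu, γ₂, hγ₂, u', hu', ?_⟩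
  rw [img_mul, hgγ, img_mul _ _ (L (tildeGL n r u')), mul_assoc, mul_assoc, img_mul,
    img_mul _ (up n γ₁),
    img_F_up_eq_of_img_F_eq hmt (Nat.le_add_right m t) (exists_mem_C_mul_iff.1 hγγ₁)]
  rfl

end

end SpCosets

theorem mainTheorem4 (n m r t : ℕ) (hm : m < n) (hr : r < n) (ht : t ≤ min (n - m) (n - r))
    (R₁ : (s : ℕ) → Set (SpCosets.GLZ (m + r + t - 2 * s)))
    (R₂ : ℕ → Set (SpCosets.GLZ (n - r)))
    (Γ₁ : ℕ → Set (SpCosets.Sp (m + t)))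
    (Γ₂ : (s : ℕ) → SpCosets.GLZ (m + r + t - 2 * s) → Set (SpCosets.Sp n))
    (hR₁ : ∀ s ∈ Set.Icc (r + m + t - n) (min m r),
      SpCosets.IsDoubleCosetReps
        (SpCosets.L ⁻¹' SpCosets.C (m + r + t - 2 * s) (m + t - s))
        (SpCosets.L ⁻¹' SpCosets.J (m + r + t - 2 * s) (r - s))
        (SpCosets.GLstar (m + r + t - 2 * s) (r - s)) (R₁ s))
    (hR₂ : ∀ s ∈ Set.Icc (r + m + t - n) (min m r),
      SpCosets.IsCosetReps (SpCosets.parabolicGL (n - r) (m + t - s)) Set.univ (R₂ s))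
    (hΓ₁ : ∀ s ∈ Set.Icc (r + m + t - n) (min m r),
      SpCosets.IsCosetReps (SpCosets.C (m + t) m) (SpCosets.M (m + t) m s t) (Γ₁ s))
    (hΓ₂ : ∀ s ∈ Set.Icc (r + m + t - n) (min m r), ∀ u ∈ R₁ s,
      SpCosets.IsCosetReps
        (SpCosets.gammaTwoGroup n (m + t + r - s) r s (SpCosets.hatGL n s u))
        (SpCosets.Jup n (m + t + r - s) r) (Γ₂ s u)) :
    Set.InjOn (SpCosets.repMatrix n m r t) (SpCosets.paramSet n m r t R₁ R₂ Γ₁ Γ₂) ∧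
    SpCosets.IsCosetReps (SpCosets.C n m) (SpCosets.M n m r t)
      (SpCosets.repMatrix n m r t '' SpCosets.paramSet n m r t R₁ R₂ Γ₁ Γ₂) := by
  have hR : ∀ s ∈ Set.Icc (r + m + t - n) (min m r),
      SpCosets.Reps n m r t s (R₁ s) (R₂ s) (Γ₁ s) (Γ₂ s) := fun s hs =>
    ⟨hR₁ s hs, hR₂ s hs, hΓ₁ s hs, hΓ₂ s hs⟩
  have hI : ∀ s, s ∈ Set.Icc (r + m + t - n) (min m r) ↔
      s ≤ m ∧ s ≤ r ∧ m + t + r ≤ n + s := by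
    intro s
    rw [Set.mem_Icc]
    omega
  have huniq : ∀ p ∈ SpCosets.paramSet n m r t R₁ R₂ Γ₁ Γ₂,
      ∀ q ∈ SpCosets.paramSet n m r t R₁ R₂ Γ₁ Γ₂,
      SpCosets.img (SpCosets.F n m) (SpCosets.repMatrix n m r t p)
        = SpCosets.img (SpCosets.F n m) (SpCosets.repMatrix n m r t q) → p = q := by
    rintro ⟨s, γ₁, u, γ₂, u'⟩ ⟨hs, hγ₁, hu, hγ₂, hu'⟩ ⟨s', δ₁, v, δ₂, v'⟩
      ⟨hs', hδ₁, hv, hδ₂, hv'⟩ he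
    obtain ⟨h1, h2, h3⟩ := (hI s).1 hs
    obtain ⟨h1', h2', h3'⟩ := (hI s').1 hs'
    have h4 := (hR s hs).img_inf_F h1 h2 h3 u' hγ₁ hu hγ₂
    have h5 := (hR s' hs').img_inf_F h1' h2' h3' v' hδ₁ hv hδ₂
    simp only [SpCosets.repMatrix] at he
    rw [he, h5] at h4
    -- The rank of the intersection with `F n r` is `n - (r + (m + t - s))`. The bounds on `s` and
    -- `s'` exclude truncated subtraction, so the rank determines `s`.
    have h6 := congrArg (fun W : Submodule ℤ (SpCosets.Vec n) => Module.finrank ℤ W) h4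
    simp only [SpCosets.finrank_img, SpCosets.finrank_F] at h6
    obtain rfl : s = s' := by
      omega
    obtain ⟨rfl, rfl, rfl, rfl⟩ :=
      (hR s hs).unique h1 h2 h3 hγ₁ hu hγ₂ hu' hδ₁ hv hδ₂ hv' he
    rfl
  refine ⟨fun p hp q hq hpq => huniq p hp q hq (by rw [hpq]), ?_, fun g hg => ?_⟩
  · rintro _ ⟨⟨s, γ₁, u, γ₂, u'⟩, ⟨hs, hγ₁, hu, hγ₂, -⟩, rfl⟩
    obtain ⟨h1, h2, h3⟩ := (hI s).1 hs
    exact (hR s hs).mem_M h1 h2 h3 u' hγ₁ hu hγ₂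
  · obtain ⟨s, h1, h2, h3, w, hw⟩ := SpCosets.exists_inf_F_eq hm.le hr.le hg
    have hs := (hI s).2 ⟨h1, h2, h3⟩
    obtain ⟨γ₁, hγ₁, u, hu, γ₂, hγ₂, u', hu', he⟩ :=
      (hR s hs).exists_rep hm.le h1 h2 h3 (by omega) hg hw
    have hp : (⟨s, γ₁, u, γ₂, u'⟩ : SpCosets.Param n m r t)
        ∈ SpCosets.paramSet n m r t R₁ R₂ Γ₁ Γ₂ := ⟨hs, hγ₁, hu, hγ₂, hu'⟩
    refine ⟨_, ⟨⟨_, hp, rfl⟩, SpCosets.exists_mem_C_mul_iff.2 he⟩, ?_⟩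
    rintro _ ⟨⟨q, hq, rfl⟩, hc⟩
    rw [huniq q hq _ hp ((SpCosets.exists_mem_C_mul_iff.1 hc).symm.trans he)]
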